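/- **Theorem (VC bound for real-valued statistical properties).** Let $S=\{X_1,\dots,X_n\}$ be a finite set of variables and let $Q$ be a statistical property with range $[A,B]\subset\mathbb R$, i.e. a map that assigns a value in $[A,B]$ to the joint distribution of each allowed tuple $(Y_1,\dots,Y_m)$ of variables from $S$ (tuples are identified up to the reorderings, if any, that are irrelevant for $Q$; the resulting classes are the allowed inputs). A model $M$ for $Q$ is a nonempty class of joint distributions of $X_1,\dots,X_n$ that agree on the value of $Q$ for every allowed input, and the model-induced property $Q_M$ maps each allowed input to this common value. A data set $D$ consists of an allowed tuple of variables, with corresponding input $S_D$, and of an $l\times m$ matrix of $l$ observations of these $m$ variables ($l$ and the tuple may vary with $D$). Let $Q_T$ be a (measurable) estimator, mapping data sets to values in $[A,B]$. Let $\mathcal M$ be a class of models for $Q$ such that $(Q_M)_{M\in\mathcal M}$ has VC dimension $h$. That is, $h$ is the largest number of allowed inputs that are shattered by the sets $Q_M^{-1}((-\infty,r])$, $M\in\mathcal M$, $r\in\mathbb R$. Let $D_1,\dots,D_k$ be data sets drawn independently from a distribution $P_D$, where $k\ge h$, and let $0<\eta<1$. Then, with probability at least $1-\eta$, the following holds simultaneously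 for all $M\in\mathcal M$: $$\mathbb E_{D\sim P_D}\bigl[|Q_T(D)-Q_M(S_D)|\bigr]\;\le\;\frac1k\sum_{j=1}^k|Q_T(D_j)-Q_M(S_{D_j})|+(B-A)\sqrt{\frac{h\left(\ln\frac kh+1\right)-\ln\frac\eta4}{k}}.$$ -/

import Mathlib

open MeasureTheory ProbabilityTheory

/-- A tuple `(Y₁, …, Y_k)`, of arbitrary length, of variables taken from `V`. -/
abbrev VarTuple (V : Type*) : Type _ := Σ k : ℕ, Fin k → V

/-- `t` arises from `s` by reordering its entries. -/
def VarTuple.IsReordering {V : Type*} (s t : VarTuple V) : Prop :=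
  ∃ σ : Fin s.1 ≃ Fin t.1, ∀ i, t.2 (σ i) = s.2 i

/-- A joint observation of the variables occurring in the tuple `t`, where the variable `v`
takes its values in `E v`. -/
abbrev VarTuple.Values {V : Type*} (E : V → Type*) (t : VarTuple V) : Type _ :=
  ∀ i : Fin t.1, E (t.2 i)

/-- The distribution of the tuple `t` under a joint distribution of all the variables. -/
noncomputable def tupleMarginal {V : Type*} {E : V → Type*} [∀ v, MeasurableSpace (E v)]
    (P : ProbabilityMeasure (∀ v, E v)) (t : VarTuple V) :
    ProbabilityMeasure (t.Values E) :=
  P.map (f := fun x i => x (t.2 i))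
    (measurable_pi_lambda _ fun i => measurable_pi_apply (t.2 i)).aemeasurable

/-- A statistical property with range `Y` of tuples of variables from `V`. It assigns a value
to the joint distribution of every allowed tuple. Some reorderings of tuples may be irrelevant:
these are recorded by an equivalence relation on the allowed tuples, and the property gives the
same value on equivalent tuples. -/
structure StatProperty (V : Type*) (E : V → Type*) [∀ v, MeasurableSpace (E v)]
    (Y : Type*) where
  /-- The tuples on which the property is defined. -/
  Allowed : Set (VarTuple V)
  /-- The irrelevant reorderings. -/
  reord : Setoid Allowed
  isReordering : ∀ s t : Allowed, reord s t → (s : VarTuple V).IsReordering t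
  /-- The value of the property at the joint distribution of an allowed tuple. -/
  val : ∀ t : Allowed, ProbabilityMeasure ((t : VarTuple V).Values E) → Y
  val_reord : ∀ (s t : Allowed) (P : ProbabilityMeasure (∀ v, E v)), reord s t →
    val s (tupleMarginal P s) = val t (tupleMarginal P t)

namespace StatProperty

variable {V : Type*} {E : V → Type*} [∀ v, MeasurableSpace (E v)] {Y : Type*}

/-- The allowed inputs ("partly ordered tuples"): allowed tuples up to irrelevant reorderings. -/
abbrev Input (Q : StatProperty V E Y) : Type _ := Quotient Q.reord

/-- A model for the property `Q`: a (nonempty) class of joint distributions of all the variables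
that agree on the value of `Q` on each allowed tuple. -/
structure Model (Q : StatProperty V E Y) where
  carrier : Set (ProbabilityMeasure (∀ v, E v))
  nonempty : carrier.Nonempty
  agree : ∀ P ∈ carrier, ∀ P' ∈ carrier, ∀ t : Q.Allowed,
    Q.val t (tupleMarginal P t) = Q.val t (tupleMarginal P' t)

/-- The model-induced property `Q_M`: the common value of `Q` on the distributions in `M`. -/
noncomputable def Model.predict {Q : StatProperty V E Y} (M : Q.Model) : Q.Input → Y :=
  Quotient.lift (fun t => Q.val t (tupleMarginal M.nonempty.some t))
    fun s t h => Q.val_reord s t _ h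

/-- The property predicted by `M` does not depend on the distribution chosen in `M`. -/
theorem Model.predict_mk {Q : StatProperty V E Y} (M : Q.Model)
    {P : ProbabilityMeasure (∀ v, E v)} (hP : P ∈ M.carrier) (t : Q.Allowed) :
    M.predict (Quotient.mk Q.reord t) = Q.val t (tupleMarginal P t) :=
  M.agree _ M.nonempty.some_mem P hP t

/-- A data set: a sample size `l`, an allowed tuple of variables and an `l × k` matrix of
observations, whose rows are the `l` joint observations of the `k` variables in the tuple.
It carries the canonical σ-algebra of this disjoint union of product spaces. -/
abbrev DataSet (Q : StatProperty V E Y) : Type _ :=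
  Σ l : ℕ, Σ t : Q.Allowed, Fin l → (t : VarTuple V).Values E

/-- The input `S_D` to which the data set `D` refers. -/
def DataSet.input {Q : StatProperty V E Y} (D : Q.DataSet) : Q.Input :=
  Quotient.mk Q.reord D.2.1

end StatProperty

/-- The family of sets `C` shatters `s`: every subset of `s` is cut out by a member of `C`. -/
def SetShatters {X : Type*} (C : Set (Set X)) (s : Finset X) : Prop :=
  ∀ t ⊆ s, ∃ c ∈ C, ∀ x ∈ s, x ∈ c ↔ x ∈ t

/-- The VC dimension of the family of sets `C` is (finite and) equal to `h`: `h` is the largest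
cardinality of a shattered set. -/
def HasVCDim {X : Type*} (C : Set (Set X)) (h : ℕ) : Prop :=
  IsGreatest {m : ℕ | ∃ s : Finset X, s.card = m ∧ SetShatters C s} h

/-- The sets `{x | f x ≤ r}`, with `f` in the class `F` and `r` a real number. -/
def sublevelSets {X : Type*} (F : Set (X → ℝ)) : Set (Set X) :=
  {c | ∃ f ∈ F, ∃ r : ℝ, c = f ⁻¹' Set.Iic r}

/-- The VC dimension of a class of real-valued functions, defined as that of the family of all
sublevel sets of its members. -/
def HasRealVCDim {X : Type*} (F : Set (X → ℝ)) (h : ℕ) : Prop :=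
  HasVCDim (sublevelSets F) h

namespace StatProperty

variable {V : Type*} {E : V → Type*} [∀ v, MeasurableSpace (E v)] {A B : ℝ}

/-- The absolute error `|Q_T(D) - Q_M(S_D)|` of the model `M` on the data set `D`, where `T` is
the estimator `Q_T`. -/
noncomputable def absError {Q : StatProperty V E (Set.Icc A B)} (T : Q.DataSet → Set.Icc A B)
    (M : Q.Model) (D : Q.DataSet) : ℝ :=
  |(T D : ℝ) - (M.predict (DataSet.input D) : ℝ)|

/-- The expected absolute error of `M` on a data set drawn from `P`. -/
noncomputable def expectedError {Q : StatProperty V E (Set.Icc A B)}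
    (T : Q.DataSet → Set.Icc A B) (P : Measure Q.DataSet) (M : Q.Model) : ℝ :=
  ∫ D, absError T M D ∂P

/-- The empirical error of `M` on the data sets `D₁, …, D_k`. -/
noncomputable def empiricalError {Q : StatProperty V E (Set.Icc A B)}
    (T : Q.DataSet → Set.Icc A B) {k : ℕ} (D : Fin k → Q.DataSet) (M : Q.Model) : ℝ :=
  (1 / (k : ℝ)) * ∑ j, absError T M (D j)

end StatProperty

/-! The proof compares the sample with an independent ghost sample of size 4k. After rescaling [A,
B] to [0, 1], |f - g| is the probability that a uniform threshold r separates f from g. Hence 4k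
times the deviation is the mean, over r and the ghost sample, of (ghost hits) - 4 (sample hits) of
the disagreement event. By Jensen, t to the power 4k · deviation is at most the mean of t to the
power of this difference (`exp_deviation_le`), so symmetrization costs no constant factor.

Markov and Tonelli reduce the tail to one fixed r. All 5k points are then exchangeable, so the
sample may be averaged over all k-subsets of the indices. The supremum over models is at most a sum
over the index sets that disagreement events cut out, and Sauer-Shelah bounds their number by the
sum of C(5k, i) over i ≤ h (`card_traces_le`). For each index set a generating function bounds the
sum over k-subsets (`sum_sampleWeight_le`). Together these give `measure_exists_deviation_le`.

It remains to choose t, and a parameter z in the estimate of the binomial sum, so that the bound is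
at most η (`exists_tail_bound`). As the logarithm contains k/h, with no extra factor inside it,
crude estimates do not suffice when h is comparable to k. The cases are split by y = h/k: a Gaussian
estimate for y ≤ 1/8, fixed (t, z) on five intervals with an endpoint check by concavity, and an
expansion around y = 1. When the radius ε is at least 1 the theorem is trivial.

Uncountable model classes reduce to sequences: there are only countably many inputs, so predictions
are pointwise limits of those of a countable subfamily, and both errors pass to the limit. -/

/-! ### Numerical bounds, binomial sums and the central coefficient C(5k, k) -/

/-- Lower bounds for logarithms from comparisons of powers with powers of `e`. -/
theorem le_log_of_pow_le {q : ℝ} (m n : ℕ) (hn : 0 < n)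
    (h : (2.7182818286 : ℝ) ^ m ≤ q ^ n) : (m : ℝ) / n ≤ Real.log q := by
  have hn' : (0 : ℝ) < n := by exact_mod_cast hn
  have h1 : Real.exp 1 ^ m ≤ q ^ n :=
    (pow_le_pow_left₀ (Real.exp_pos 1).le Real.exp_one_lt_d9.le m).trans h
  have h2 := Real.log_le_log (by positivity) h1
  rw [Real.log_pow, Real.log_pow, Real.log_exp, mul_one] at h2
  rw [div_le_iff₀ hn']
  linarith

/-- Upper bounds for logarithms from comparisons of powers with powers of `e`. -/
theorem log_le_of_le_pow {q : ℝ} (hq : 0 < q) (m n : ℕ) (hn : 0 < n)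
    (h : q ^ n ≤ (2.7182818283 : ℝ) ^ m) : Real.log q ≤ (m : ℝ) / n := by
  have hn' : (0 : ℝ) < n := by exact_mod_cast hn
  have h1 : q ^ n ≤ Real.exp 1 ^ m :=
    h.trans (pow_le_pow_left₀ (by norm_num) Real.exp_one_gt_d9.le m)
  have h2 := Real.log_le_log (by positivity) h1
  rw [Real.log_pow, Real.log_pow, Real.log_exp, mul_one] at h2
  rw [le_div_iff₀ hn']
  linarith

/-- The exponent, per sample point, of the moment generating function of the difference of the
frequencies of a set in a sample and in a ghost sample of four times its size. -/
noncomputable def ghostRate (t : ℝ) : ℝ :=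
  5 * Real.log ((1 + t + t ^ 2 + t ^ 3 + t ^ 4) / 5) -
    4 * Real.log ((1 + t + t ^ 2 + t ^ 3) / 4) - 4 * Real.log t

/-- Since z ≤ 1, z^h ≤ z^i for i ≤ h, so z^h times the sum is part of the binomial expansion of (1 +
z)^N. The parameter z stays free to be tuned to h/k. -/
theorem sauer_sum_le (N h : ℕ) {z : ℝ} (hz : 0 < z) (hz1 : z ≤ 1) :
    ((∑ i ∈ Finset.Iic h, N.choose i : ℕ) : ℝ) ≤ z⁻¹ ^ h * (1 + z) ^ N := by
  have h1 : (1 + z) ^ N = ∑ i ∈ Finset.range (N + 1), z ^ i * (N.choose i : ℝ) := by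
    rw [add_comm, add_pow]; simp
  have h2 : ∑ i ∈ Finset.Iic h, z ^ i * (N.choose i : ℝ) ≤ (1 + z) ^ N := by
    rw [h1, ← Finset.sum_filter_add_sum_filter_not (Finset.Iic h) (· ∈ Finset.range (N + 1))]
    have : ∑ i ∈ (Finset.Iic h).filter (fun i => ¬ i ∈ Finset.range (N + 1)),
        z ^ i * (N.choose i : ℝ) = 0 := by
      refine Finset.sum_eq_zero fun i hi => ?_
      have : N < i := by simpa [Nat.lt_succ_iff] using (Finset.mem_filter.1 hi).2
      simp [Nat.choose_eq_zero_of_lt this]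
    rw [this, add_zero]
    refine Finset.sum_le_sum_of_subset_of_nonneg (fun i hi => (Finset.mem_filter.1 hi).2) ?_
    intros; positivity
  have h3 : z ^ h * ((∑ i ∈ Finset.Iic h, N.choose i : ℕ) : ℝ) ≤ (1 + z) ^ N := by
    refine le_trans ?_ h2
    push_cast
    rw [Finset.mul_sum]
    refine Finset.sum_le_sum fun i hi => ?_
    exact mul_le_mul_of_nonneg_right (pow_le_pow_of_le_one hz.le hz1 (Finset.mem_Iic.1 hi))
      (Nat.cast_nonneg _)
  rw [inv_pow, ← div_eq_inv_mul, le_div_iff₀ (by positivity)]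
  linarith

theorem choose_five_mul_succ (k : ℕ) :
    (4 * k + 4) * (4 * k + 3) * (4 * k + 2) * (4 * k + 1) * (5 * (k + 1)).choose (k + 1) =
      5 * (5 * k + 4) * (5 * k + 3) * (5 * k + 2) * (5 * k + 1) * (5 * k).choose k := by
  have h1 : (5 * (k + 1)).choose (k + 1) * (k + 1).factorial * (4 * k + 4).factorial
      = (5 * k + 5).factorial := by
    have := Nat.choose_mul_factorial_mul_factorial (n := 5 * (k + 1)) (k := k + 1) (by omega)
    rw [show 5 * (k + 1) - (k + 1) = 4 * k + 4 by omega] at this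
    rw [this]; rfl
  have h2 : (5 * k).choose k * k.factorial * (4 * k).factorial = (5 * k).factorial := by
    have := Nat.choose_mul_factorial_mul_factorial (n := 5 * k) (k := k) (by omega)
    rwa [show 5 * k - k = 4 * k by omega] at this
  have h3 : (5 * k + 5).factorial = (5 * k + 5) * (5 * k + 4) * (5 * k + 3) * (5 * k + 2) *
      (5 * k + 1) * (5 * k).factorial := by
    simp only [Nat.factorial_succ]; ring
  have h4 : (4 * k + 4).factorial = (4 * k + 4) * (4 * k + 3) * (4 * k + 2) * (4 * k + 1) *
      (4 * k).factorial := by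
    simp only [Nat.factorial_succ]; ring
  rw [h3, h4, ← h2, Nat.factorial_succ] at h1
  have hpos : 0 < (k + 1) * k.factorial * (4 * k).factorial := by positivity
  apply Nat.eq_of_mul_eq_mul_left hpos
  linarith

/-- A bound of Stirling order, by induction on the ratio of consecutive coefficients. The constant
3125/1280 gives equality at k = 1. -/
theorem le_choose_five_mul {k : ℕ} (hk : 1 ≤ k) :
    (3125 / 256 : ℝ) ^ k ≤ 3125 / 1280 * √k * ((5 * k).choose k : ℝ) := by
  induction k, hk using Nat.le_induction with
  | base => norm_num [Nat.choose]
  | succ k hk ih =>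
    have hrec := choose_five_mul_succ k
    have hrec' : (4 * k + 4) * (4 * k + 3) * (4 * k + 2) * (4 * k + 1) *
        ((5 * (k + 1)).choose (k + 1) : ℝ) =
      5 * (5 * k + 4) * (5 * k + 3) * (5 * k + 2) * (5 * k + 1) * ((5 * k).choose k : ℝ) := by
      exact_mod_cast hrec
    have hk0 : (1 : ℝ) ≤ k := by exact_mod_cast hk
    set p : ℝ := (4 * k + 4) * (4 * k + 3) * (4 * k + 2) * (4 * k + 1) with hp
    set q : ℝ := 5 * (5 * k + 4) * (5 * k + 3) * (5 * k + 2) * (5 * k + 1) with hq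
    have hp0 : 0 < p := by positivity
    have hq0 : 0 < q := by positivity
    have key : 3125 / 256 * (√k * p) ≤ √(k + 1) * q := by
      refine abs_le_of_sq_le_sq' ?_ (by positivity) |>.2
      rw [mul_pow, mul_pow √(k : ℝ), mul_pow √((k : ℝ) + 1), Real.sq_sqrt (by positivity),
        Real.sq_sqrt (by positivity)]
      -- In the variable a = k - 1 the difference of the two squares is a polynomial with
      -- nonnegative coefficients.
      obtain ⟨a, ha⟩ : ∃ a : ℝ, (k : ℝ) = 1 + a := ⟨k - 1, by ring⟩
      have ha0 : 0 ≤ a := by linarith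
      rw [hp, hq, ha, ← sub_nonneg]
      ring_nf
      positivity
    have hc : ((5 * (k + 1)).choose (k + 1) : ℝ) = q / p * ((5 * k).choose k : ℝ) := by
      field_simp; linarith
    rw [hc, pow_succ]
    push_cast
    calc (3125 / 256 : ℝ) ^ k * (3125 / 256)
        ≤ 3125 / 1280 * √k * ((5 * k).choose k : ℝ) * (3125 / 256) := by gcongr
      _ = 3125 / 1280 * ((5 * k).choose k : ℝ) * ((3125 / 256 * (√k * p)) / p) := by
          field_simp
      _ ≤ 3125 / 1280 * ((5 * k).choose k : ℝ) * ((√(k + 1) * q) / p) := by gcongr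
      _ = _ := by ring

/-! ### Choice of t and z: small h/k -/

/-- Both polynomials in t are palindromic, so up to powers of t they depend only on d = cosh τ - 1,
and the terms linear in τ cancel. What remains is at most 5d - 7d²/4, whose quadratic part absorbs
the quartic term of cosh. -/
theorem ghostRate_exp_le {τ : ℝ} (h0 : 0 ≤ τ) (h1 : τ ≤ 4 / 5) :
    ghostRate (Real.exp τ) ≤ 5 / 2 * τ ^ 2 := by
  set t := Real.exp τ with ht
  have htpos : 0 < t := Real.exp_pos τ
  have hlog : Real.log t = τ := Real.log_exp τ
  set d := Real.cosh τ - 1 with hd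
  have hc : t ^ 2 + 1 = 2 * t * (1 + d) := by
    rw [hd, Real.cosh_eq, Real.exp_neg, ← ht]; field_simp; ring
  have hd0 : 0 ≤ d := by have := Real.one_le_cosh τ; linarith
  have hdv : d ≤ τ ^ 2 / 2 + 209 / 4000 * τ ^ 4 := by
    have e1 := Real.exp_bound (x := τ) (by rw [abs_of_nonneg h0]; linarith) (n := 4) (by norm_num)
    have e2 := Real.exp_bound (x := -τ) (by rw [abs_neg, abs_of_nonneg h0]; linarith)
      (n := 4) (by norm_num)
    have e1' := (abs_le.1 e1).2
    have e2' := (abs_le.1 e2).2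
    rw [abs_of_nonneg h0] at e1'
    rw [abs_neg, abs_of_nonneg h0] at e2'
    norm_num [Finset.sum_range_succ, Nat.factorial] at e1' e2'
    rw [hd, Real.cosh_eq]
    have : 0 ≤ τ ^ 4 := by positivity
    nlinarith
  have hτ2 : τ ^ 2 ≤ 16 / 25 := by nlinarith
  have hd1 : d ≤ 35 / 100 := by nlinarith [sq_nonneg τ, mul_nonneg (sq_nonneg τ) (sub_nonneg.2 hτ2)]
  have hA : Real.log (1 + 2 * d + 4 / 5 * d ^ 2) ≤ 2 * d - 4 / 5 * d ^ 2 := by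
    rw [Real.log_le_iff_le_exp (by positivity)]
    have hv : 0 ≤ 2 * d - 4 / 5 * d ^ 2 := by nlinarith
    have := Real.sum_le_exp_of_nonneg hv 4
    norm_num [Finset.sum_range_succ, Nat.factorial] at this
    refine le_trans ?_ this
    have hx : (2 * d - 4 / 5 * d ^ 2) ^ 2 / 2 + (2 * d - 4 / 5 * d ^ 2) ^ 3 / 6 - 8 / 5 * d ^ 2
      = d ^ 2 * (2 / 5 - 4 / 15 * d - 32 / 25 * d ^ 2 + d ^ 3 * (16 / 25 - 32 / 375 * d)) := by ring
    have : 0 ≤ d ^ 2 * (2 / 5 - 4 / 15 * d - 32 / 25 * d ^ 2 + d ^ 3 * (16 / 25 - 32 / 375 * d)) := by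
      have : 0 ≤ d ^ 3 * (16 / 25 - 32 / 375 * d) := mul_nonneg (by positivity) (by linarith)
      apply mul_nonneg (by positivity)
      nlinarith
    linarith
  have hB : d - d ^ 2 / 2 ≤ Real.log (1 + d) := by
    refine le_trans ?_ (Real.le_log_one_add_of_nonneg hd0)
    rw [le_div_iff₀ (by positivity)]
    nlinarith [pow_nonneg hd0 3]
  have hC : d / 2 - d ^ 2 / 8 ≤ Real.log (1 + d / 2) := by
    refine le_trans ?_ (Real.le_log_one_add_of_nonneg (by positivity : 0 ≤ d / 2))
    rw [le_div_iff₀ (by positivity)]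
    nlinarith [pow_nonneg hd0 3]
  have h5 : Real.log ((1 + t + t ^ 2 + t ^ 3 + t ^ 4) / 5) =
      2 * τ + Real.log (1 + 2 * d + 4 / 5 * d ^ 2) := by
    have : (1 + t + t ^ 2 + t ^ 3 + t ^ 4) / 5 = t ^ 2 * (1 + 2 * d + 4 / 5 * d ^ 2) := by
      have : 1 + t + t ^ 2 + t ^ 3 + t ^ 4 = (t ^ 2 + 1) ^ 2 + t * (t ^ 2 + 1) - t ^ 2 := by ring
      rw [this, hc]; ring
    rw [this, Real.log_mul (by positivity) (by positivity), Real.log_pow, hlog]; norm_num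
  have h4 : Real.log ((1 + t + t ^ 2 + t ^ 3) / 4) =
      τ + Real.log (1 + d) + (τ + Real.log (1 + d / 2)) / 2 := by
    have e1 : (1 + t + t ^ 2 + t ^ 3) / 4 = t * (1 + d) * ((1 + t) / 2) := by
      have : 1 + t + t ^ 2 + t ^ 3 = (t ^ 2 + 1) * (1 + t) := by ring
      rw [this, hc]; ring
    have e2 : ((1 + t) / 2) ^ 2 = t * (1 + d / 2) := by
      have : (1 + t) ^ 2 = (t ^ 2 + 1) + 2 * t := by ring
      rw [div_pow, this, hc]; ring
    have e3 := congrArg Real.log e2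
    rw [Real.log_pow, Real.log_mul (by positivity) (by positivity), hlog] at e3
    rw [e1, Real.log_mul (by positivity) (by positivity),
      Real.log_mul (by positivity) (by positivity), hlog]
    push_cast at e3
    linarith
  rw [ghostRate, h5, h4, hlog]
  have hfin : 5 * d - 7 / 4 * d ^ 2 ≤ 5 / 2 * τ ^ 2 := by
    set D := τ ^ 2 / 2 + 209 / 4000 * τ ^ 4 with hD
    have hDv : D ≤ 4 / 10 := by
      rw [hD]; nlinarith [sq_nonneg τ, mul_nonneg (sq_nonneg τ) (sub_nonneg.2 hτ2)]
    have : 5 * d - 7 / 4 * d ^ 2 ≤ 5 * D - 7 / 4 * D ^ 2 := by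
      nlinarith [mul_nonneg (sub_nonneg.2 hdv) (by linarith : 0 ≤ 5 - 7 / 4 * (D + d))]
    have h6 : τ ^ 4 / 4 ≤ D ^ 2 := by
      rw [hD]
      have : (τ ^ 2 / 2 + 209 / 4000 * τ ^ 4) ^ 2 = τ ^ 4 / 4 + 209 / 4000 * τ ^ 6 +
        (209 / 4000 * τ ^ 4) ^ 2 := by ring
      rw [this]
      have : 0 ≤ 209 / 4000 * τ ^ 6 + (209 / 4000 * τ ^ 4) ^ 2 := by positivity
      linarith
    have : 0 ≤ τ ^ 4 := by positivity
    rw [hD] at *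
    linarith
  linarith

theorem exponent_bound_of_le_eighth {h k : ℕ} (hh : 1 ≤ h) (hk : 8 * h ≤ k) {ε ℓ : ℝ}
    (hℓ : Real.log 4 ≤ ℓ) (hε : k * ε ^ 2 = h * (Real.log (k / h) + 1) + ℓ)
    (hε0 : 0 < ε) (hε1 : ε < 1) :
    ∃ t z : ℝ, 1 < t ∧ 0 < z ∧ z ≤ 1 ∧ 1 / 2 * Real.log k - 4936 / 10000 ≤
      k * (4 * ε * Real.log t - ghostRate t) + h * Real.log z - 5 * k * Real.log (1 + z) - ℓ := by
  have hh' : (1 : ℝ) ≤ h := by exact_mod_cast hh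
  have hk' : (8 : ℝ) * h ≤ k := by exact_mod_cast hk
  have hk0 : (0 : ℝ) < k := by linarith
  -- τ = 4ε/5 maximizes 4ετ - 5τ²/2, with value 8ε²/5. z = h/(5k) gives the familiar bound
  -- (5ek/h)^h. The surplus 3kε²/5 pays for log 5 and √k because log (k/h) ≥ log 8.
  refine ⟨Real.exp (4 / 5 * ε), h / k / 5, Real.one_lt_exp_iff.2 (by positivity), by positivity,
    ?_, ?_⟩
  · rw [div_div, div_le_one (by positivity)]; linarith
  have hg := ghostRate_exp_le (τ := 4 / 5 * ε) (by positivity) (by linarith)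
  set X := Real.log (k / h : ℝ) with hX
  have hX8 : (207 / 100 : ℝ) ≤ X := by
    have h1 : Real.log 8 ≤ X := Real.log_le_log (by norm_num) (by
      rw [le_div_iff₀ (by positivity)]; linarith)
    have h2 : Real.log 8 = 3 * Real.log 2 := by
      rw [show (8 : ℝ) = 2 ^ 3 by norm_num, Real.log_pow]; norm_num
    linarith [Real.log_two_gt_d9]
  have hlogk : Real.log k = Real.log h + X := by
    rw [hX, Real.log_div (by positivity) (by positivity)]; ring
  have hz : Real.log (h / k / 5 : ℝ) = -X - Real.log 5 := by
    rw [Real.log_div (by positivity) (by norm_num), hX, ← Real.log_inv, inv_div]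
  have hz1 : Real.log (1 + h / k / 5 : ℝ) ≤ h / k / 5 := by
    have := Real.log_le_sub_one_of_pos (x := 1 + h / k / 5) (by positivity); linarith
  have hz2 : 5 * (k : ℝ) * Real.log (1 + h / k / 5 : ℝ) ≤ h := by
    calc _ ≤ 5 * (k : ℝ) * (h / k / 5) := by gcongr
      _ = h := by field_simp
  have hlogh : Real.log h ≤ h / 4 + Real.log 4 - 1 := by
    have := Real.log_le_sub_one_of_pos (x := (h / 4 : ℝ)) (by positivity)
    rw [Real.log_div (by positivity) (by norm_num)] at this
    linarith
  have hlog4 : Real.log 4 = 2 * Real.log 2 := by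
    rw [show (4 : ℝ) = 2 ^ 2 by norm_num, Real.log_pow]; norm_num
  have hlog5 : Real.log 5 ≤ 16096 / 10000 := by
    refine (log_le_of_le_pow (by norm_num) 169 105 (by norm_num) (by norm_num)).trans ?_
    norm_num
  have h2l := Real.log_two_gt_d9
  have h2u := Real.log_two_lt_d9
  have hg' : (k : ℝ) * ghostRate (Real.exp (4 / 5 * ε)) ≤ k * (5 / 2 * (4 / 5 * ε) ^ 2) := by
    gcongr
  rw [Real.log_exp, hz, hlogk]
  have h7 : (h : ℝ) * Real.log 5 ≤ h * (16096 / 10000) := by gcongr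
  have h8 : 0 ≤ ((h : ℝ) - 1) * (6 / 10 * X - 11346 / 10000) :=
    mul_nonneg (by linarith) (by linarith)
  nlinarith

/-! ### Choice of t and z: intermediate h/k, by interpolation -/

/-- Once ℓ is eliminated, the exponent depends on ε through 4ετ - ε². Monotonicity allows ε to be
replaced by its value for ℓ = 0, namely √(y (1 - log y)). -/
theorem sub_sq_mono {r ε τ : ℝ} (hr : r ≤ ε) (hε : ε ≤ 1) (hτ : 1 / 2 ≤ τ) :
    4 * r * τ - r ^ 2 ≤ 4 * ε * τ - ε ^ 2 := by
  nlinarith [mul_nonneg (sub_nonneg.2 hr) (by linarith : 0 ≤ 4 * τ - ε - r)]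

/-- An affine function whose squares at two points are dominated by `y (1 - log y)` is dominated,
between the two points, by every `ε` with `y (1 - log y) ≤ ε ^ 2`. -/
theorem affine_le_of_sq_le {y₁ y₂ a b ε₁ ε₂ ε : ℝ} (hy₁ : 0 < y₁) (hy₂ : 0 < y₂) (ha : 0 ≤ a)
    (hb : 0 ≤ b) (hab : a + b = 1) (hε : 0 ≤ ε)
    (h₁ : ε₁ ^ 2 ≤ y₁ * (1 - Real.log y₁)) (h₂ : ε₂ ^ 2 ≤ y₂ * (1 - Real.log y₂))
    (h : (a * y₁ + b * y₂) * (1 - Real.log (a * y₁ + b * y₂)) ≤ ε ^ 2) :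
    a * ε₁ + b * ε₂ ≤ ε := by
  refine (abs_le_of_sq_le_sq' (le_trans ?_ h) hε).2
  have hc := Real.concaveOn_negMulLog.2 (Set.mem_Ici.2 hy₁.le) (Set.mem_Ici.2 hy₂.le) ha hb hab
  simp only [Real.negMulLog, smul_eq_mul] at hc
  have hs : (a * ε₁ + b * ε₂) ^ 2 ≤ a * ε₁ ^ 2 + b * ε₂ ^ 2 := by
    have : a * ε₁ ^ 2 + b * ε₂ ^ 2 - (a * ε₁ + b * ε₂) ^ 2 = a * b * (ε₁ - ε₂) ^ 2 := by
      rw [show b = 1 - a by linarith]; ring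
    have : 0 ≤ a * b * (ε₁ - ε₂) ^ 2 := by positivity
    linarith
  nlinarith [mul_le_mul_of_nonneg_left h₁ ha, mul_le_mul_of_nonneg_left h₂ hb]

/-- A tangent-line bound for the logarithm. It turns the target into the requirement that each
sample point contributes at least 0.0686. -/
theorem half_log_le {k : ℝ} (hk : 0 < k) :
    1 / 2 * Real.log k - 4936 / 10000 ≤ 686 / 10000 * k := by
  have h1 := Real.log_le_sub_one_of_pos (x := k * (1372 / 10000)) (by positivity)
  have h2 : Real.log (10000 / 1372) ≤ 1987 / 1000 := by
    refine (log_le_of_le_pow (by norm_num) 151 76 (by norm_num) (by norm_num)).trans ?_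
    norm_num
  rw [show (1372 / 10000 : ℝ) = (10000 / 1372)⁻¹ by norm_num, Real.log_mul (by positivity)
    (by positivity), Real.log_inv] at h1
  norm_num at h1 h2 ⊢
  linarith

/-- With t and z fixed, the exponent per sample point at ℓ = 0 is affine in y plus a positive
multiple of √(y (1 - log y)). The root is at least its interpolation between ε₁ and ε₂, so the
values at the two endpoints decide. -/
theorem exponent_bound_of_endpoints {h k : ℕ} {ε ℓ t z y₁ y₂ ε₁ ε₂ : ℝ} (hh : 1 ≤ h)
    (hy₁ : 0 < y₁) (hy : y₁ < y₂) (hk₁ : y₁ * k ≤ h) (hk₂ : h ≤ y₂ * k)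
    (hℓ : 0 ≤ ℓ) (hε : k * ε ^ 2 = h * (Real.log (k / h) + 1) + ℓ)
    (hε0 : 0 < ε) (hε1 : ε < 1) (ht : 1 / 2 ≤ Real.log t)
    (h₁ : ε₁ ^ 2 ≤ y₁ * (1 - Real.log y₁)) (h₂ : ε₂ ^ 2 ≤ y₂ * (1 - Real.log y₂))
    (hv₁ : 686 / 10000 ≤ 4 * ε₁ * Real.log t - ghostRate t + y₁ * Real.log z
      - 5 * Real.log (1 + z))
    (hv₂ : 686 / 10000 ≤ 4 * ε₂ * Real.log t - ghostRate t + y₂ * Real.log z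
      - 5 * Real.log (1 + z)) :
    1 / 2 * Real.log k - 4936 / 10000 ≤
      k * (4 * ε * Real.log t - ghostRate t) + h * Real.log z - 5 * k * Real.log (1 + z) - ℓ := by
  have hh' : (1 : ℝ) ≤ h := by exact_mod_cast hh
  have hk0 : (0 : ℝ) < k := by
    rcases Nat.eq_zero_or_pos k with rfl | hk
    · simp at hk₂; linarith
    · exact_mod_cast hk
  set y : ℝ := h / k with hydef
  have hhy : (h : ℝ) = y * k := by rw [hydef]; field_simp
  have hy0 : 0 < y := by positivity
  have hlog : Real.log (k / h : ℝ) = - Real.log y := by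
    rw [hydef, ← Real.log_inv, inv_div]
  have hyl : y₁ ≤ y := by rw [hydef, le_div_iff₀ hk0]; exact hk₁
  have hyu : y ≤ y₂ := by rw [hydef, div_le_iff₀ hk0]; exact hk₂
  have he0 : y * (1 - Real.log y) ≤ ε ^ 2 := by
    rw [hlog, hhy] at hε
    have : 0 ≤ k * (ε ^ 2 - y * (1 - Real.log y)) := by nlinarith
    have := nonneg_of_mul_nonneg_right this hk0
    linarith
  set r := √(y * (1 - Real.log y)) with hr
  set b := (y - y₁) / (y₂ - y₁) with hb
  have hb0 : 0 ≤ b := div_nonneg (by linarith) (by linarith)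
  have hb1 : b ≤ 1 := by rw [hb, div_le_one (by linarith)]; linarith
  have hyb : (1 - b) * y₁ + b * y₂ = y := by
    have h21 : y₂ - y₁ ≠ 0 := by linarith
    rw [hb]; field_simp; ring
  have hpos : 0 ≤ y * (1 - Real.log y) := by
    rw [← hyb]
    have hc := Real.concaveOn_negMulLog.2 (Set.mem_Ici.2 hy₁.le)
      (Set.mem_Ici.2 (hy₁.trans hy).le) (sub_nonneg.2 hb1) hb0 (by ring)
    simp only [Real.negMulLog, smul_eq_mul] at hc
    nlinarith [mul_le_mul_of_nonneg_left h₁ (sub_nonneg.2 hb1), mul_le_mul_of_nonneg_left h₂ hb0,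
      mul_nonneg (sub_nonneg.2 hb1) (sq_nonneg ε₁), mul_nonneg hb0 (sq_nonneg ε₂)]
  have hrr : r ^ 2 = y * (1 - Real.log y) := Real.sq_sqrt hpos
  have hrε : r ≤ ε := Real.sqrt_le_iff.2 ⟨hε0.le, he0⟩
  have haff : (1 - b) * ε₁ + b * ε₂ ≤ r :=
    affine_le_of_sq_le hy₁ (hy₁.trans hy) (sub_nonneg.2 hb1) hb0 (by ring) (Real.sqrt_nonneg _)
      h₁ h₂ (by rw [hyb, hrr])
  have hmono := sub_sq_mono hrε hε1.le ht
  have hval : 686 / 10000 ≤ 4 * r * Real.log t - ghostRate t + y * Real.log z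
      - 5 * Real.log (1 + z) := by
    have e1 := mul_le_mul_of_nonneg_left hv₁ (sub_nonneg.2 hb1)
    have e2 := mul_le_mul_of_nonneg_left hv₂ hb0
    have e3 := mul_le_mul_of_nonneg_right haff (by linarith : 0 ≤ 4 * Real.log t)
    have e4 : y * Real.log z = ((1 - b) * y₁ + b * y₂) * Real.log z := by rw [hyb]
    rw [e4]
    linarith
  refine (half_log_le hk0).trans ?_
  have hfin : k * (686 / 10000) ≤ k * (4 * ε * Real.log t - ghostRate t + y * Real.log z
      - 5 * Real.log (1 + z) - ε ^ 2 + y * (1 - Real.log y)) := by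
    gcongr
    linarith
  have hℓ' : ℓ = k * (ε ^ 2 - y * (1 - Real.log y)) := by
    rw [hlog, hhy] at hε; linarith
  rw [hℓ', hhy]
  linarith

/-! ### Choice of t and z: h close to k -/

/-- Expansion for large t = 1/s: the leading powers contribute (5·4 - 4·3 - 4) log t, and the rest
is s to first order. -/
theorem ghostRate_inv_le {s : ℝ} (hs0 : 0 < s) (hs1 : s ≤ 1 / 40) :
    ghostRate s⁻¹ ≤ 4 * Real.log s⁻¹ - 5 * Real.log 5 + 4 * Real.log 4 + 103 / 100 * s := by
  obtain ⟨g, hg⟩ : ∃ g, g = 1 + s + s ^ 2 + s ^ 3 := ⟨_, rfl⟩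
  have hg1 : 1 ≤ g := by rw [hg]; have : 0 ≤ s + s ^ 2 + s ^ 3 := by positivity
                         linarith
  have hτ : Real.log s⁻¹ = - Real.log s := Real.log_inv s
  have e5 : (1 + s⁻¹ + s⁻¹ ^ 2 + s⁻¹ ^ 3 + s⁻¹ ^ 4) / 5 = g * (1 + s ^ 4 / g) * s⁻¹ ^ 4 / 5 := by
    have : g * (1 + s ^ 4 / g) = g + s ^ 4 := by field_simp
    rw [this, hg]; field_simp; ring
  have e4 : (1 + s⁻¹ + s⁻¹ ^ 2 + s⁻¹ ^ 3) / 4 = g * s⁻¹ ^ 3 / 4 := by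
    rw [hg]; field_simp; ring
  have hg0 : 0 < g := by linarith
  have hq : 0 ≤ s ^ 4 / g := by positivity
  rw [ghostRate, e5, e4, Real.log_div (by positivity) (by positivity),
    Real.log_div (by positivity) (by positivity), Real.log_mul (by positivity) (by positivity),
    Real.log_mul (by positivity) (by positivity), Real.log_mul (by positivity) (by positivity),
    Real.log_pow, Real.log_pow]
  have f1 := Real.log_le_sub_one_of_pos hg0
  have f2 := Real.log_le_sub_one_of_pos (x := 1 + s ^ 4 / g) (by positivity)
  have f3 : s ^ 4 / g ≤ s ^ 4 := div_le_self (by positivity) hg1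
  have g2 : s ^ 2 ≤ 1 / 40 * s := by nlinarith
  have g3 : s ^ 3 ≤ 1 / 1600 * s := by
    calc s ^ 3 = s * s ^ 2 := by ring
      _ ≤ s * (1 / 1600) := by gcongr; nlinarith
      _ = _ := by ring
  have g4 : s ^ 4 ≤ 1 / 1600 * s := by
    calc s ^ 4 = s * s ^ 3 := by ring
      _ ≤ s * (1 / 1600) := by gcongr; nlinarith
      _ = _ := by ring
  push_cast
  linarith

theorem one_sub_mul_one_sub_log_le {y : ℝ} (hy0 : 0 < y) (hy1 : y < 1) :
    1 - y * (1 - Real.log y) ≤ (1 - y) ^ 2 / (1 + y) := by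
  have h1 := Real.le_log_one_add_of_nonneg (x := (1 - y) / y) (div_nonneg (by linarith) hy0.le)
  have h2 : 1 + (1 - y) / y = y⁻¹ := by field_simp; ring
  rw [h2, Real.log_inv] at h1
  have h3 : 2 * ((1 - y) / y) / ((1 - y) / y + 2) = 2 * (1 - y) / (1 + y) := by
    have : (1 - y) / y + 2 = (1 + y) / y := by field_simp; ring
    rw [this]; field_simp
  rw [h3] at h1
  have h4 : (1 - y) ^ 2 / (1 + y) = 1 - y * (1 + 2 * (1 - y) / (1 + y)) := by
    field_simp; ring
  rw [h4]
  have := mul_le_mul_of_nonneg_left h1 hy0.le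
  linarith

theorem mul_log_four_div_le {u : ℝ} (hu0 : 0 < u) (hu1 : u ≤ 1 / 10) :
    u * Real.log (4 / u) ≤ 37 / 100 := by
  have e1 : Real.log (4 / u) = Real.log 40 + Real.log (1 / 10 / u) := by
    rw [← Real.log_mul (by norm_num) (by positivity)]; congr 1; field_simp; norm_num
  have e2 := Real.log_le_sub_one_of_pos (x := 1 / 10 / u) (by positivity)
  have e3 : Real.log 40 ≤ 37 / 10 := by
    refine (log_le_of_le_pow (by norm_num) 37 10 (by norm_num) (by norm_num)).trans ?_
    norm_num
  have e4 : (1 : ℝ) ≤ Real.log 40 := by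
    refine le_trans ?_ (le_log_of_pow_le 1 1 (by norm_num) (by norm_num))
    norm_num
  have e5 : u * (1 / 10 / u) = 1 / 10 := by field_simp
  calc u * Real.log (4 / u) ≤ u * (Real.log 40 + (1 / 10 / u - 1)) := by rw [e1]; gcongr
    _ = u * (Real.log 40 - 1) + u * (1 / 10 / u) := by ring
    _ ≤ 1 / 10 * (Real.log 40 - 1) + 1 / 10 := by
      rw [e5]; gcongr
    _ ≤ _ := by linarith

/-- With u = 1 - h/k, the condition ε < 1 leaves room for ℓ only of order ku². Since ℓ ≥ log 4, u is
at least of order 1/√k, and a gain linear in u is of order √k in total. -/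
theorem exponent_bound_of_near_one {h k : ℕ} (hh : 1 ≤ h) (hk : h ≤ k)
    (hk9 : (9 : ℝ) / 10 * k ≤ h) {ε ℓ : ℝ} (hℓ : Real.log 4 ≤ ℓ)
    (hε : k * ε ^ 2 = h * (Real.log (k / h) + 1) + ℓ) (hε0 : 0 < ε) (hε1 : ε < 1) :
    ∃ t z : ℝ, 1 < t ∧ 0 < z ∧ z ≤ 1 ∧ 1 / 2 * Real.log k - 4936 / 10000 ≤
      k * (4 * ε * Real.log t - ghostRate t) + h * Real.log z - 5 * k * Real.log (1 + z) - ℓ := by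
  have hh' : (1 : ℝ) ≤ h := by exact_mod_cast hh
  have hkh : (h : ℝ) ≤ k := by exact_mod_cast hk
  have hk0 : (0 : ℝ) < k := by linarith
  have hlog4 : Real.log 4 = 2 * Real.log 2 := by
    rw [show (4 : ℝ) = 2 ^ 2 by norm_num, Real.log_pow]; norm_num
  have h2l := Real.log_two_gt_d9
  have h2u := Real.log_two_lt_d9
  set y : ℝ := h / k with hydef
  have hhy : (h : ℝ) = y * k := by rw [hydef]; field_simp
  have hy0 : 0 < y := by positivity
  have hlog : Real.log (k / h : ℝ) = - Real.log y := by
    rw [hydef, ← Real.log_inv, inv_div]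
  have hyl : 9 / 10 ≤ y := by rw [hydef, le_div_iff₀ hk0]; exact hk9
  rw [hlog, hhy] at hε
  have hε2 : ε ^ 2 < 1 := pow_lt_one₀ hε0.le hε1 two_ne_zero
  have hlt : ℓ < k * (1 - y * (1 - Real.log y)) := by
    have := mul_lt_mul_of_pos_left hε2 hk0
    linarith
  have hy1 : y < 1 := by
    refine lt_of_le_of_ne (by rw [hydef, div_le_one hk0]; exact hkh) fun h1 => ?_
    rw [h1] at hlt; simp at hlt; linarith
  obtain ⟨u, hu⟩ : ∃ u, u = 1 - y := ⟨_, rfl⟩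
  have hu0 : 0 < u := by linarith
  have hu1 : u ≤ 1 / 10 := by linarith
  have he0 := one_sub_mul_one_sub_log_le hy0 hy1
  rw [show 1 + y = 2 - u by rw [hu]; ring, ← hu] at he0
  have he0' : 1 - y * (1 - Real.log y) ≤ 10 / 19 * u ^ 2 := by
    refine he0.trans ?_
    rw [div_le_iff₀ (by linarith)]; nlinarith [sq_nonneg u]
  have hepos : 0 ≤ y * (1 - Real.log y) :=
    mul_nonneg hy0.le (by linarith [Real.log_nonpos hy0.le hy1.le])
  have hle : y * (1 - Real.log y) ≤ ε ^ 2 := by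
    have : 0 ≤ k * (ε ^ 2 - y * (1 - Real.log y)) := by linarith [Real.log_pos one_lt_two]
    have := nonneg_of_mul_nonneg_right this hk0
    linarith
  set r := √(y * (1 - Real.log y)) with hr
  have hrr : r ^ 2 = y * (1 - Real.log y) := Real.sq_sqrt hepos
  have hr0 : 0 ≤ r := Real.sqrt_nonneg _
  have hrε : r ≤ ε := Real.sqrt_le_iff.2 ⟨hε0.le, hle⟩
  have hr1 : 1 - r ≤ 10 / 19 * u ^ 2 := by
    have : r ^ 2 ≤ r := by rw [sq]; exact mul_le_of_le_one_left hr0 (hrε.trans hε1.le)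
    linarith
  obtain ⟨s, hs⟩ : ∃ s, s = u / 4 := ⟨_, rfl⟩
  have hs0 : 0 < s := by rw [hs]; positivity
  have hs1 : s ≤ 1 / 40 := by linarith
  have hτ : Real.log s⁻¹ = - Real.log s := Real.log_inv s
  have hK := ghostRate_inv_le hs0 hs1
  have hulog : u * Real.log s⁻¹ ≤ 37 / 100 := by
    rw [hs, inv_div]; exact mul_log_four_div_le hu0 hu1
  have hτ1 : 1 / 2 ≤ Real.log s⁻¹ := by
    have : (1 : ℝ) / 1 ≤ Real.log 40 := by
      have := le_log_of_pow_le (q := 40) 1 1 (by norm_num) (by norm_num)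
      simpa using this
    have h40 : Real.log 40 ≤ Real.log s⁻¹ := Real.log_le_log (by norm_num) (by
      rw [le_inv_comm₀ (by norm_num) hs0]; linarith)
    linarith
  -- For z = 1/4 the constants 5 log 5 and 4 log 4 cancel against those of `ghostRate` at h = k. For
  -- t = 4/u the loss 4(1 - r) log t is only of order u² log (4/u), while u log 4 is gained.
  refine ⟨s⁻¹, 1 / 4, ?_, by norm_num, by norm_num, ?_⟩
  · rw [one_lt_inv₀ hs0]; linarith
  have hmono := sub_sq_mono hrε hε1.le hτ1
  have hz : Real.log (1 / 4 : ℝ) = - Real.log 4 := by rw [one_div, Real.log_inv]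
  have hz1 : Real.log (1 + 1 / 4 : ℝ) = Real.log 5 - Real.log 4 := by
    rw [← Real.log_div (by norm_num) (by norm_num)]; norm_num
  have hmain : k * (54 / 160 * u) ≤ k * (4 * ε * Real.log s⁻¹ - ghostRate s⁻¹ + y * Real.log (1 / 4)
      - 5 * Real.log (1 + 1 / 4) - ε ^ 2 + y * (1 - Real.log y)) := by
    gcongr
    rw [hz, hz1, show y * -Real.log 4 = u * Real.log 4 - Real.log 4 by rw [hu]; ring]
    have e1 : (1 - r) * Real.log s⁻¹ ≤ 10 / 19 * u ^ 2 * Real.log s⁻¹ := by gcongr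
    have e2 : 10 / 19 * u ^ 2 * Real.log s⁻¹ ≤ 10 / 19 * u * (37 / 100) := by
      calc _ = 10 / 19 * u * (u * Real.log s⁻¹) := by ring
        _ ≤ _ := by gcongr
    have e3 : u * (138629 / 100000) ≤ u * Real.log 4 := by gcongr; linarith
    linarith
  -- From log 4 ≤ ℓ < k · (10/19) u².
  have hsq : 8 / 5 ≤ u * √k := by
    refine (abs_le_of_sq_le_sq' ?_ (by positivity)).2
    rw [mul_pow, Real.sq_sqrt hk0.le]
    have : k * (1 - y * (1 - Real.log y)) ≤ k * (10 / 19 * u ^ 2) := by gcongr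
    linarith
  have hkk : √k * √k = k := Real.mul_self_sqrt hk0.le
  have hlogk : 1 / 2 * Real.log k ≤ √k / 2 + Real.log 2 - 1 := by
    have e1 := Real.log_le_sub_one_of_pos (x := √k / 2) (by positivity)
    rw [Real.log_div (by positivity) (by positivity), Real.log_sqrt hk0.le] at e1
    linarith
  have hku : 54 / 100 * √k ≤ k * (54 / 160 * u) := by
    calc 54 / 100 * √k = 54 / 160 * √k * (8 / 5) := by ring
      _ ≤ 54 / 160 * √k * (u * √k) := by gcongr
      _ = 54 / 160 * (√k * √k) * u := by ring
      _ = _ := by rw [hkk]; ring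
  have hℓ' : ℓ = k * (ε ^ 2 - y * (1 - Real.log y)) := by linarith
  have : 0 ≤ √(k : ℝ) := Real.sqrt_nonneg _
  rw [hℓ', hhy]
  linarith

/-! ### Numerical verification at the breakpoints, and the tail estimate -/

theorem sq_le_mul_one_sub_log {y e : ℝ} (hy : 0 < y) (m n : ℕ) (hn : 0 < n)
    (hl : (2.7182818286 : ℝ) ^ m ≤ y⁻¹ ^ n) (he : e ^ 2 ≤ y * (1 + m / n)) :
    e ^ 2 ≤ y * (1 - Real.log y) := by
  have h := le_log_of_pow_le m n hn hl
  rw [Real.log_inv] at h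
  refine he.trans ?_
  gcongr
  linarith

/-- Each logarithm is replaced by a rational bound in the unfavourable direction, which leaves
rational arithmetic. -/
theorem ghostRate_value_bound {e₁ e₂ y₁ y₂ t z τ ζ ξ α β : ℝ} (hy₁ : 0 ≤ y₁) (hy₂ : 0 ≤ y₂)
    (he₁ : 0 ≤ e₁) (he₂ : 0 ≤ e₂) (hτ : τ ≤ Real.log t) (hζ : Real.log z⁻¹ ≤ ζ)
    (hξ : Real.log (1 + z) ≤ ξ)
    (hα : Real.log ((1 + t + t ^ 2 + t ^ 3 + t ^ 4) / 5) ≤ α)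
    (hβ : β ≤ Real.log ((1 + t + t ^ 2 + t ^ 3) / 4))
    (h₁ : 686 / 10000 ≤ 4 * e₁ * τ - (5 * α - 4 * β - 4 * τ) - y₁ * ζ - 5 * ξ)
    (h₂ : 686 / 10000 ≤ 4 * e₂ * τ - (5 * α - 4 * β - 4 * τ) - y₂ * ζ - 5 * ξ) :
    686 / 10000 ≤ 4 * e₁ * Real.log t - ghostRate t + y₁ * Real.log z - 5 * Real.log (1 + z) ∧
    686 / 10000 ≤ 4 * e₂ * Real.log t - ghostRate t + y₂ * Real.log z - 5 * Real.log (1 + z) := by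
  rw [Real.log_inv] at hζ
  have a1 := mul_le_mul_of_nonneg_left hτ (by positivity : 0 ≤ 4 * e₁)
  have a2 := mul_le_mul_of_nonneg_left hτ (by positivity : 0 ≤ 4 * e₂)
  have b1 := mul_le_mul_of_nonneg_left hζ hy₁
  have b2 := mul_le_mul_of_nonneg_left hζ hy₂
  unfold ghostRate
  constructor <;> linarith

-- This and the next five results give rational lower bounds for √(y (1 - log y)) at the breakpoints
-- of h/k.
set_option exponentiation.threshold 2000 in
theorem entropy_bound_eighth : (31021 / 50000 : ℝ) ^ 2 ≤ (1 / 8 : ℝ) * (1 - Real.log (1 / 8)) :=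
  sq_le_mul_one_sub_log (by norm_num) 445 214 (by norm_num) (by norm_num) (by norm_num)

set_option exponentiation.threshold 2000 in
theorem entropy_bound_fifth : (903 / 1250 : ℝ) ^ 2 ≤ (1 / 5 : ℝ) * (1 - Real.log (1 / 5)) :=
  sq_le_mul_one_sub_log (by norm_num) 103 64 (by norm_num) (by norm_num) (by norm_num)

set_option exponentiation.threshold 2000 in
theorem entropy_bound_seventeen_fiftieths : (8407 / 10000 : ℝ) ^ 2 ≤ (17 / 50 : ℝ) * (1 - Real.log (17 / 50)) :=
  sq_le_mul_one_sub_log (by norm_num) 178 165 (by norm_num) (by norm_num) (by norm_num)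

set_option exponentiation.threshold 2000 in
theorem entropy_bound_half : (11501 / 12500 : ℝ) ^ 2 ≤ (1 / 2 : ℝ) * (1 - Real.log (1 / 2)) :=
  sq_le_mul_one_sub_log (by norm_num) 131 189 (by norm_num) (by norm_num) (by norm_num)

set_option exponentiation.threshold 2000 in
theorem entropy_bound_seven_tenths : (1949 / 2000 : ℝ) ^ 2 ≤ (7 / 10 : ℝ) * (1 - Real.log (7 / 10)) :=
  sq_le_mul_one_sub_log (by norm_num) 51 143 (by norm_num) (by norm_num) (by norm_num)

set_option exponentiation.threshold 2000 in
theorem entropy_bound_nine_tenths : (12467 / 12500 : ℝ) ^ 2 ≤ (9 / 10 : ℝ) * (1 - Real.log (9 / 10)) :=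
  sq_le_mul_one_sub_log (by norm_num) 2 19 (by norm_num) (by norm_num) (by norm_num)

set_option exponentiation.threshold 2000 in
theorem ghostRate_values_eighth :
    686 / 10000 ≤ 4 * (31021 / 50000) * Real.log (19 / 10) - ghostRate (19 / 10) +
      1 / 8 * Real.log (1 / 33) - 5 * Real.log (1 + 1 / 33) ∧
    686 / 10000 ≤ 4 * (903 / 1250) * Real.log (19 / 10) - ghostRate (19 / 10) +
      1 / 5 * Real.log (1 / 33) - 5 * Real.log (1 + 1 / 33) := by
  refine ghostRate_value_bound (τ := (43 : ℕ) / (67 : ℕ)) (ζ := (507 : ℕ) / (145 : ℕ))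
    (ξ := (7 : ℕ) / (234 : ℕ)) (α := (208 : ℕ) / (125 : ℕ)) (β := (146 : ℕ) / (121 : ℕ))
    (by norm_num) (by norm_num) (by norm_num) (by norm_num)
    (le_log_of_pow_le _ _ (by norm_num) (by norm_num))
    (log_le_of_le_pow (by norm_num) _ _ (by norm_num) (by norm_num))
    (log_le_of_le_pow (by norm_num) _ _ (by norm_num) (by norm_num))
    (log_le_of_le_pow (by norm_num) _ _ (by norm_num) (by norm_num))
    (le_log_of_pow_le _ _ (by norm_num) (by norm_num)) ?_ ?_ <;> norm_num

set_option exponentiation.threshold 2000 in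
theorem ghostRate_values_fifth :
    686 / 10000 ≤ 4 * (903 / 1250) * Real.log (5 / 2) - ghostRate (5 / 2) +
      1 / 5 * Real.log (1 / 22) - 5 * Real.log (1 + 1 / 22) ∧
    686 / 10000 ≤ 4 * (8407 / 10000) * Real.log (5 / 2) - ghostRate (5 / 2) +
      17 / 50 * Real.log (1 / 22) - 5 * Real.log (1 + 1 / 22) := by
  refine ghostRate_value_bound (τ := (197 : ℕ) / (215 : ℕ)) (ζ := (745 : ℕ) / (241 : ℕ))
    (ξ := (11 : ℕ) / (247 : ℕ)) (α := (386 : ℕ) / (151 : ℕ)) (β := (109 : ℕ) / (59 : ℕ))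
    (by norm_num) (by norm_num) (by norm_num) (by norm_num)
    (le_log_of_pow_le _ _ (by norm_num) (by norm_num))
    (log_le_of_le_pow (by norm_num) _ _ (by norm_num) (by norm_num))
    (log_le_of_le_pow (by norm_num) _ _ (by norm_num) (by norm_num))
    (log_le_of_le_pow (by norm_num) _ _ (by norm_num) (by norm_num))
    (le_log_of_pow_le _ _ (by norm_num) (by norm_num)) ?_ ?_ <;> norm_num

set_option exponentiation.threshold 2000 in
theorem ghostRate_values_seventeen_fiftieths :
    686 / 10000 ≤ 4 * (8407 / 10000) * Real.log (7 / 2) - ghostRate (7 / 2) +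
      17 / 50 * Real.log (1 / 11) - 5 * Real.log (1 + 1 / 11) ∧
    686 / 10000 ≤ 4 * (11501 / 12500) * Real.log (7 / 2) - ghostRate (7 / 2) +
      1 / 2 * Real.log (1 / 11) - 5 * Real.log (1 + 1 / 11) := by
  refine ghostRate_value_bound (τ := (114 : ℕ) / (91 : ℕ)) (ζ := (458 : ℕ) / (191 : ℕ))
    (ξ := (21 : ℕ) / (241 : ℕ)) (α := (609 : ℕ) / (163 : ℕ)) (β := (154 : ℕ) / (57 : ℕ))
    (by norm_num) (by norm_num) (by norm_num) (by norm_num)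
    (le_log_of_pow_le _ _ (by norm_num) (by norm_num))
    (log_le_of_le_pow (by norm_num) _ _ (by norm_num) (by norm_num))
    (log_le_of_le_pow (by norm_num) _ _ (by norm_num) (by norm_num))
    (log_le_of_le_pow (by norm_num) _ _ (by norm_num) (by norm_num))
    (le_log_of_pow_le _ _ (by norm_num) (by norm_num)) ?_ ?_ <;> norm_num

set_option exponentiation.threshold 2000 in
theorem ghostRate_values_half :
    686 / 10000 ≤ 4 * (11501 / 12500) * Real.log (7) - ghostRate (7) +
      1 / 2 * Real.log (1 / 8) - 5 * Real.log (1 + 1 / 8) ∧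
    686 / 10000 ≤ 4 * (1949 / 2000) * Real.log (7) - ghostRate (7) +
      7 / 10 * Real.log (1 / 8) - 5 * Real.log (1 + 1 / 8) := by
  refine ghostRate_value_bound (τ := (467 : ℕ) / (240 : ℕ)) (ζ := (314 : ℕ) / (151 : ℕ))
    (ξ := (29 : ℕ) / (246 : ℕ)) (α := (424 : ℕ) / (67 : ℕ)) (β := (1073 : ℕ) / (233 : ℕ))
    (by norm_num) (by norm_num) (by norm_num) (by norm_num)
    (le_log_of_pow_le _ _ (by norm_num) (by norm_num))
    (log_le_of_le_pow (by norm_num) _ _ (by norm_num) (by norm_num))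
    (log_le_of_le_pow (by norm_num) _ _ (by norm_num) (by norm_num))
    (log_le_of_le_pow (by norm_num) _ _ (by norm_num) (by norm_num))
    (le_log_of_pow_le _ _ (by norm_num) (by norm_num)) ?_ ?_ <;> norm_num

set_option exponentiation.threshold 2000 in
theorem ghostRate_values_seven_tenths :
    686 / 10000 ≤ 4 * (1949 / 2000) * Real.log (32) - ghostRate (32) +
      7 / 10 * Real.log (1 / 5) - 5 * Real.log (1 + 1 / 5) ∧
    686 / 10000 ≤ 4 * (12467 / 12500) * Real.log (32) - ghostRate (32) +
      9 / 10 * Real.log (1 / 5) - 5 * Real.log (1 + 1 / 5) := by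
  refine ghostRate_value_bound (τ := (707 : ℕ) / (204 : ℕ)) (ζ := (375 : ℕ) / (233 : ℕ))
    (ξ := (31 : ℕ) / (170 : ℕ)) (α := (86 : ℕ) / (7 : ℕ)) (β := (1908 : ℕ) / (211 : ℕ))
    (by norm_num) (by norm_num) (by norm_num) (by norm_num)
    (le_log_of_pow_le _ _ (by norm_num) (by norm_num))
    (log_le_of_le_pow (by norm_num) _ _ (by norm_num) (by norm_num))
    (log_le_of_le_pow (by norm_num) _ _ (by norm_num) (by norm_num))
    (log_le_of_le_pow (by norm_num) _ _ (by norm_num) (by norm_num))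
    (le_log_of_pow_le _ _ (by norm_num) (by norm_num)) ?_ ?_ <;> norm_num

set_option exponentiation.threshold 2000 in
theorem exists_exponent_bound {h k : ℕ} (hh : 1 ≤ h) (hk : h ≤ k) {ε ℓ : ℝ}
    (hℓ : Real.log 4 ≤ ℓ) (hε : k * ε ^ 2 = h * (Real.log (k / h) + 1) + ℓ)
    (hε0 : 0 < ε) (hε1 : ε < 1) :
    ∃ t z : ℝ, 1 < t ∧ 0 < z ∧ z ≤ 1 ∧ 1 / 2 * Real.log k - 4936 / 10000 ≤
      k * (4 * ε * Real.log t - ghostRate t) + h * Real.log z - 5 * k * Real.log (1 + z) - ℓ := by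
  have hℓ0 : 0 ≤ ℓ := (Real.log_nonneg (by norm_num)).trans hℓ
  rcases le_total (8 * h) k with h0 | h0
  · exact exponent_bound_of_le_eighth hh h0 hℓ hε hε0 hε1
  replace h0 : (1 / 8 : ℝ) * k ≤ h := by
    have : (k : ℝ) ≤ 8 * h := by exact_mod_cast h0
    linarith
  rcases le_total (h : ℝ) (1 / 5 * k) with hb | hb
  · refine ⟨19 / 10, 1 / 33, by norm_num, by norm_num, by norm_num, ?_⟩
    exact exponent_bound_of_endpoints hh (by norm_num) (by norm_num) h0 hb hℓ0 hε hε0 hε1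
      ((by norm_num : (1 / 2 : ℝ) ≤ (43 : ℕ) / (67 : ℕ)).trans
        (le_log_of_pow_le _ _ (by norm_num) (by norm_num)))
      entropy_bound_eighth entropy_bound_fifth ghostRate_values_eighth.1
      ghostRate_values_eighth.2
  have h1 := hb
  rcases le_total (h : ℝ) (17 / 50 * k) with hb | hb
  · refine ⟨5 / 2, 1 / 22, by norm_num, by norm_num, by norm_num, ?_⟩
    exact exponent_bound_of_endpoints hh (by norm_num) (by norm_num) h1 hb hℓ0 hε hε0 hε1
      ((by norm_num : (1 / 2 : ℝ) ≤ (197 : ℕ) / (215 : ℕ)).trans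
        (le_log_of_pow_le _ _ (by norm_num) (by norm_num)))
      entropy_bound_fifth entropy_bound_seventeen_fiftieths ghostRate_values_fifth.1
      ghostRate_values_fifth.2
  have h2 := hb
  rcases le_total (h : ℝ) (1 / 2 * k) with hb | hb
  · refine ⟨7 / 2, 1 / 11, by norm_num, by norm_num, by norm_num, ?_⟩
    exact exponent_bound_of_endpoints hh (by norm_num) (by norm_num) h2 hb hℓ0 hε hε0 hε1
      ((by norm_num : (1 / 2 : ℝ) ≤ (114 : ℕ) / (91 : ℕ)).trans
        (le_log_of_pow_le _ _ (by norm_num) (by norm_num)))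
      entropy_bound_seventeen_fiftieths entropy_bound_half ghostRate_values_seventeen_fiftieths.1
      ghostRate_values_seventeen_fiftieths.2
  have h3 := hb
  rcases le_total (h : ℝ) (7 / 10 * k) with hb | hb
  · refine ⟨7, 1 / 8, by norm_num, by norm_num, by norm_num, ?_⟩
    exact exponent_bound_of_endpoints hh (by norm_num) (by norm_num) h3 hb hℓ0 hε hε0 hε1
      ((by norm_num : (1 / 2 : ℝ) ≤ (467 : ℕ) / (240 : ℕ)).trans
        (le_log_of_pow_le _ _ (by norm_num) (by norm_num)))
      entropy_bound_half entropy_bound_seven_tenths ghostRate_values_half.1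
      ghostRate_values_half.2
  have h4 := hb
  rcases le_total (h : ℝ) (9 / 10 * k) with hb | hb
  · refine ⟨32, 1 / 5, by norm_num, by norm_num, by norm_num, ?_⟩
    exact exponent_bound_of_endpoints hh (by norm_num) (by norm_num) h4 hb hℓ0 hε hε0 hε1
      ((by norm_num : (1 / 2 : ℝ) ≤ (707 : ℕ) / (204 : ℕ)).trans
        (le_log_of_pow_le _ _ (by norm_num) (by norm_num)))
      entropy_bound_seven_tenths entropy_bound_nine_tenths ghostRate_values_seven_tenths.1
      ghostRate_values_seven_tenths.2
  have h5 := hb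
  exact exponent_bound_of_near_one hh hk h5 hℓ hε hε0 hε1

/-- The factor 3125/256 = 5⁵/4⁴ is the exponential growth rate of C(5k, k), by which the bound is
divided. -/
theorem exp_ghostRate {t : ℝ} (ht : 0 < t) :
    (1 + t + t ^ 2 + t ^ 3 + t ^ 4) ^ 5 / ((1 + t + t ^ 2 + t ^ 3) ^ 4 * t ^ 4) =
      3125 / 256 * Real.exp (ghostRate t) := by
  have e5 : Real.exp (5 * Real.log ((1 + t + t ^ 2 + t ^ 3 + t ^ 4) / 5)) =
      ((1 + t + t ^ 2 + t ^ 3 + t ^ 4) / 5) ^ 5 := by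
    rw [← Real.exp_log (show 0 < ((1 + t + t ^ 2 + t ^ 3 + t ^ 4) / 5) ^ 5 by positivity),
      Real.log_pow]; norm_num
  have e4 : Real.exp (4 * Real.log ((1 + t + t ^ 2 + t ^ 3) / 4)) =
      ((1 + t + t ^ 2 + t ^ 3) / 4) ^ 4 := by
    rw [← Real.exp_log (show 0 < ((1 + t + t ^ 2 + t ^ 3) / 4) ^ 4 by positivity),
      Real.log_pow]; norm_num
  have et : Real.exp (4 * Real.log t) = t ^ 4 := by
    rw [← Real.exp_log (show 0 < t ^ 4 by positivity), Real.log_pow]; norm_num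
  rw [ghostRate, Real.exp_sub, Real.exp_sub, e5, e4, et]
  have : 0 < 1 + t + t ^ 2 + t ^ 3 := by positivity
  field_simp
  norm_num

theorem exists_tail_bound {h k : ℕ} (hh : 1 ≤ h) (hk : h ≤ k) {ε η : ℝ} (hη0 : 0 < η)
    (hη1 : η < 1) (hε : k * ε ^ 2 = h * (Real.log (k / h) + 1) - Real.log (η / 4))
    (hε0 : 0 < ε) (hε1 : ε < 1) :
    ∃ t : ℝ, 1 < t ∧ ((∑ i ∈ Finset.Iic h, (5 * k).choose i : ℕ) : ℝ) *
      ((1 + t + t ^ 2 + t ^ 3 + t ^ 4) ^ 5 / ((1 + t + t ^ 2 + t ^ 3) ^ 4 * t ^ 4)) ^ k /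
        ((5 * k).choose k : ℝ) ≤ η * Real.exp (4 * k * ε * Real.log t) := by
  have hk1 : 1 ≤ k := hh.trans hk
  have hk0 : (0 : ℝ) < k := by exact_mod_cast hk1
  rw [Real.log_div hη0.ne' (by norm_num)] at hε
  obtain ⟨t, z, ht, hz0, hz1, H⟩ := exists_exponent_bound hh hk (ℓ := Real.log 4 - Real.log η)
    (by linarith [Real.log_neg hη0 hη1]) (by linarith) hε0 hε1
  refine ⟨t, ht, ?_⟩
  have ht0 : 0 < t := by linarith
  have hC0 : (0 : ℝ) < ((5 * k).choose k : ℝ) := by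
    exact_mod_cast Nat.choose_pos (by omega)
  have hS := sauer_sum_le (5 * k) h hz0 hz1
  have hC := le_choose_five_mul hk1
  -- The 4 in η/4 pays for the constant 3125/1280; the remainder is the 0.4936 of the exponent
  -- bounds.
  have hc : Real.log (3125 / 1280) ≤ Real.log 4 - 4936 / 10000 := by
    have h1 : (4936 / 10000 : ℝ) ≤ Real.log (4 / (3125 / 1280)) := by
      refine le_trans ?_ (le_log_of_pow_le 39 79 (by norm_num) (by norm_num))
      norm_num
    rw [Real.log_div (by norm_num) (by norm_num)] at h1
    linarith
  rw [exp_ghostRate ht0, mul_pow, ← Real.exp_nat_mul, div_le_iff₀ hC0]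
  have hz : z⁻¹ ^ h = Real.exp (-(h * Real.log z)) := by
    rw [← Real.log_pow, ← Real.log_inv, Real.exp_log (by positivity), inv_pow]
  have hz' : (1 + z) ^ (5 * k) = Real.exp (5 * k * Real.log (1 + z)) := by
    rw [← Real.exp_log (show 0 < (1 + z) ^ (5 * k) by positivity), Real.log_pow]; push_cast; rfl
  have hsq : √(k : ℝ) = Real.exp (1 / 2 * Real.log k) := by
    rw [← Real.exp_log (Real.sqrt_pos.2 hk0), Real.log_sqrt hk0.le]; congr 1; ring
  calc ((∑ i ∈ Finset.Iic h, (5 * k).choose i : ℕ) : ℝ) *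
        ((3125 / 256) ^ k * Real.exp (k * ghostRate t))
      ≤ (z⁻¹ ^ h * (1 + z) ^ (5 * k)) * ((3125 / 1280 * √k * ((5 * k).choose k : ℝ)) *
          Real.exp (k * ghostRate t)) := by gcongr
    _ = Real.exp (-(h * Real.log z) + 5 * k * Real.log (1 + z) + Real.log (3125 / 1280) +
          1 / 2 * Real.log k + k * ghostRate t) * ((5 * k).choose k : ℝ) := by
        rw [Real.exp_add, Real.exp_add, Real.exp_add, Real.exp_add, hz, hz', hsq,
          Real.exp_log (by norm_num : (0 : ℝ) < 3125 / 1280)]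
        ring
    _ ≤ Real.exp (Real.log η + 4 * k * ε * Real.log t) * ((5 * k).choose k : ℝ) := by
        refine mul_le_mul_of_nonneg_right (Real.exp_le_exp.2 ?_) hC0.le
        linarith
    _ = _ := by rw [Real.exp_add, Real.exp_log hη0]

/-! ### Averaging over k-subsets by exchangeability -/

/-- The weight of the set of indices `A` relative to the sample `S`: each element of `A`
contributes `t⁻⁴` if it belongs to the sample and `t` otherwise. -/
noncomputable def sampleWeight {ι : Type*} [Fintype ι] [DecidableEq ι] (t : ℝ)
    (S A : Finset ι) : ℝ :=
  ∏ i, if i ∈ A then (if i ∈ S then (t ^ 4)⁻¹ else t) else 1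

theorem sampleWeight_nonneg {ι : Type*} [Fintype ι] [DecidableEq ι] {t : ℝ} (ht : 0 < t)
    (S A : Finset ι) : 0 ≤ sampleWeight t S A := by
  refine Finset.prod_nonneg fun i _ => ?_
  split_ifs <;> positivity

/-- The sum is the coefficient of z^k in a product over the indices. All terms being nonnegative, it
is at most the product divided by z^k, for any z > 0. -/
theorem sum_sampleWeight_le {ι : Type*} [Fintype ι] [DecidableEq ι] {t : ℝ} (ht : 1 < t) {k : ℕ}
    (hcard : Fintype.card ι = 5 * k) (A : Finset ι) :
    ∑ S ∈ Finset.powersetCard k Finset.univ, sampleWeight t S A ≤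
      ((1 + t + t ^ 2 + t ^ 3 + t ^ 4) ^ 5 / ((1 + t + t ^ 2 + t ^ 3) ^ 4 * t ^ 4)) ^ k := by
  have ht0 : 0 < t := by linarith
  -- For this z, indices inside and outside A give the same factor 1 + z, so the bound does not
  -- depend on A.
  obtain ⟨z, hz⟩ : ∃ z, z = t ^ 4 / (1 + t + t ^ 2 + t ^ 3) := ⟨_, rfl⟩
  have hG : 0 < 1 + t + t ^ 2 + t ^ 3 := by positivity
  have hz0 : 0 < z := by rw [hz]; positivity
  have hzt : z * (t ^ 4)⁻¹ + t = 1 + z := by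
    rw [hz]; field_simp; ring
  let f : ι → ℝ := fun i => if i ∈ A then z * (t ^ 4)⁻¹ else z
  let g : ι → ℝ := fun i => if i ∈ A then t else 1
  have hfg : ∏ i, (f i + g i) = (1 + z) ^ (5 * k) := by
    rw [← hcard, ← Finset.card_univ, ← Finset.prod_const]
    refine Finset.prod_congr rfl fun i _ => ?_
    simp only [f, g]
    split_ifs
    · exact hzt
    · ring
  have hw : ∀ S ∈ Finset.powersetCard k (Finset.univ : Finset ι), z ^ k * sampleWeight t S A =
      (∏ i ∈ S, f i) * ∏ i ∈ Finset.univ \ S, g i := by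
    intro S hS
    rw [← (Finset.mem_powersetCard.1 hS).2, ← Finset.prod_const, sampleWeight,
      ← Finset.prod_sdiff (Finset.subset_univ S), mul_comm (∏ i ∈ Finset.univ \ S, _), ← mul_assoc,
      ← Finset.prod_mul_distrib]
    congr 1
    · refine Finset.prod_congr rfl fun i hi => ?_
      simp only [f, hi, if_true]
      split_ifs <;> simp
    · refine Finset.prod_congr rfl fun i hi => ?_
      have : i ∉ S := (Finset.mem_sdiff.1 hi).2
      simp only [g, this, if_false]
  have hsum : z ^ k * ∑ S ∈ Finset.powersetCard k Finset.univ, sampleWeight t S A ≤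
      (1 + z) ^ (5 * k) := by
    rw [Finset.mul_sum, Finset.sum_congr rfl hw, ← hfg, Finset.prod_add]
    refine Finset.sum_le_sum_of_subset_of_nonneg
      (fun S hS => Finset.mem_powerset.2 (Finset.mem_powersetCard.1 hS).1) fun S _ _ => ?_
    refine mul_nonneg (Finset.prod_nonneg fun i _ => ?_) (Finset.prod_nonneg fun i _ => ?_)
    · simp only [f]; split_ifs <;> positivity
    · simp only [g]; split_ifs <;> positivity
  have hbase : (1 + t + t ^ 2 + t ^ 3 + t ^ 4) ^ 5 / ((1 + t + t ^ 2 + t ^ 3) ^ 4 * t ^ 4) =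
      (1 + z) ^ 5 / z := by
    have : 1 + z = (1 + t + t ^ 2 + t ^ 3 + t ^ 4) / (1 + t + t ^ 2 + t ^ 3) := by
      rw [hz]; field_simp
    rw [this, hz]; field_simp
  rw [hbase, div_pow, ← pow_mul, le_div_iff₀ (by positivity)]
  linarith

open Classical in
/-- The set of indices whose sample point lies in `C`. -/
noncomputable def hitSet {ι 𝒟 : Type*} [Fintype ι] (C : Set 𝒟) (z : ι → 𝒟) : Finset ι :=
  Finset.univ.filter fun i => z i ∈ C

theorem mem_hitSet {ι 𝒟 : Type*} [Fintype ι] {C : Set 𝒟} {z : ι → 𝒟} {i : ι} :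
    i ∈ hitSet C z ↔ z i ∈ C := by
  simp [hitSet]

open Classical in
/-- The index sets cut out of a finite sample by a sequence of sets. -/
noncomputable def traces {ι 𝒟 : Type*} [Fintype ι] (C : ℕ → Set 𝒟) (z : ι → 𝒟) :
    Finset (Finset ι) :=
  Finset.univ.filter fun A => ∃ n, hitSet (C n) z = A

theorem measurable_sampleWeight_hitSet {ι 𝒟 Θ : Type*} [Fintype ι] [DecidableEq ι]
    [MeasurableSpace Θ] {t : ℝ} (S : Finset ι) {C : Θ → Set 𝒟} {z : Θ → ι → 𝒟}
    (h : ∀ i, MeasurableSet {θ | z θ i ∈ C θ}) :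
    Measurable fun θ => sampleWeight t S (hitSet (C θ) (z θ)) := by
  unfold sampleWeight
  refine Finset.measurable_prod _ fun i _ => ?_
  exact Measurable.ite (by simpa only [mem_hitSet] using h i) measurable_const measurable_const

theorem sampleWeight_hitSet_comp {ι 𝒟 : Type*} [Fintype ι] [DecidableEq ι] (t : ℝ) (C : Set 𝒟)
    (e : Equiv.Perm ι) (S : Finset ι) (z : ι → 𝒟) : sampleWeight t S (hitSet C fun i => z (e i)) =
      sampleWeight t (S.map e.toEmbedding) (hitSet C z) := by
  unfold sampleWeight
  conv_rhs => rw [← Equiv.prod_comp e]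
  refine Finset.prod_congr rfl fun i _ => ?_
  have h : (i ∈ hitSet C fun i => z (e i)) ↔ e i ∈ hitSet C z := by simp only [mem_hitSet]
  simp [h]

section Exchangeable

variable {ι 𝒟 : Type*} [Fintype ι] [DecidableEq ι] [MeasurableSpace 𝒟]

theorem lintegral_iSup_sampleWeight_map (P : Measure 𝒟) [SigmaFinite P] (t : ℝ)
    (C : ℕ → Set 𝒟) (e : Equiv.Perm ι) (S : Finset ι) :
    ∫⁻ z, ⨆ n, ENNReal.ofReal (sampleWeight t (S.map e.toEmbedding) (hitSet (C n) z))
        ∂Measure.pi (fun _ : ι => P) =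
      ∫⁻ z, ⨆ n, ENNReal.ofReal (sampleWeight t S (hitSet (C n) z))
        ∂Measure.pi (fun _ : ι => P) := by
  have hmp := measurePreserving_piCongrLeft (fun _ : ι => P) e
  rw [← hmp.lintegral_comp_emb (MeasurableEquiv.measurableEmbedding _)]
  refine lintegral_congr fun z => ?_
  congr 1
  funext n
  rw [← sampleWeight_hitSet_comp]
  congr 3
  funext i
  simp [MeasurableEquiv.coe_piCongrLeft, Equiv.piCongrLeft_apply_apply]

/-- Some permutation of the indices carries S to S', and the product measure is invariant under it.
-/
theorem lintegral_iSup_sampleWeight_eq (P : Measure 𝒟) [SigmaFinite P] (t : ℝ)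
    (C : ℕ → Set 𝒟) {S S' : Finset ι} (h : S.card = S'.card) :
    ∫⁻ z, ⨆ n, ENNReal.ofReal (sampleWeight t S' (hitSet (C n) z))
        ∂Measure.pi (fun _ : ι => P) =
      ∫⁻ z, ⨆ n, ENNReal.ofReal (sampleWeight t S (hitSet (C n) z))
        ∂Measure.pi (fun _ : ι => P) := by
  obtain ⟨e, he⟩ : ∃ e : Equiv.Perm ι, S.map e.toEmbedding = S' := by
    let e₀ : {x // x ∈ S} ≃ {x // x ∈ S'} := Finset.equivOfCardEq h
    refine ⟨e₀.extendSubtype, ?_⟩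
    refine Finset.eq_of_subset_of_card_le (fun x hx => ?_) (by simp [h])
    obtain ⟨y, hy, rfl⟩ := Finset.mem_map.1 hx
    exact Equiv.extendSubtype_mem e₀ y hy
  rw [← he, lintegral_iSup_sampleWeight_map]

/-- The integral for S equals its average over all C(5k, k) subsets of size k. Pointwise, the
supremum over n is at most the sum over the at most m traces, and each trace is handled by
`sum_sampleWeight_le`. -/
theorem lintegral_iSup_sampleWeight_le (P : Measure 𝒟) [IsProbabilityMeasure P] {t : ℝ}
    (ht : 1 < t) {k : ℕ} (hcard : Fintype.card ι = 5 * k) {C : ℕ → Set 𝒟}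
    (hC : ∀ n, MeasurableSet (C n)) {m : ℕ} (hm : ∀ z : ι → 𝒟, (traces C z).card ≤ m)
    {S : Finset ι} (hS : S.card = k) :
    ∫⁻ z, ⨆ n, ENNReal.ofReal (sampleWeight t S (hitSet (C n) z)) ∂Measure.pi (fun _ : ι => P) ≤
      ENNReal.ofReal (m *
        ((1 + t + t ^ 2 + t ^ 3 + t ^ 4) ^ 5 / ((1 + t + t ^ 2 + t ^ 3) ^ 4 * t ^ 4)) ^ k /
          ((5 * k).choose k : ℝ)) := by
  have ht0 : 0 < t := by linarith
  set R := ((1 + t + t ^ 2 + t ^ 3 + t ^ 4) ^ 5 / ((1 + t + t ^ 2 + t ^ 3) ^ 4 * t ^ 4)) ^ k with hR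
  have hR0 : 0 ≤ R := by positivity
  have hN : (0 : ℝ) < ((5 * k).choose k : ℝ) := by
    exact_mod_cast Nat.choose_pos (by omega)
  have hsum : ∑ S' ∈ Finset.powersetCard k (Finset.univ : Finset ι),
      ∫⁻ z, ⨆ n, ENNReal.ofReal (sampleWeight t S' (hitSet (C n) z)) ∂Measure.pi (fun _ : ι => P) ≤
      ENNReal.ofReal (m * R) := by
    rw [← lintegral_finsetSum]
    · calc _ ≤ ∫⁻ _z : ι → 𝒟, ENNReal.ofReal (m * R) ∂Measure.pi (fun _ : ι => P) := by
            refine lintegral_mono fun z => ?_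
            calc ∑ S' ∈ Finset.powersetCard k (Finset.univ : Finset ι),
                  ⨆ n, ENNReal.ofReal (sampleWeight t S' (hitSet (C n) z))
                ≤ ∑ S' ∈ Finset.powersetCard k (Finset.univ : Finset ι),
                  ∑ A ∈ traces C z, ENNReal.ofReal (sampleWeight t S' A) := by
                  refine Finset.sum_le_sum fun S' _ => iSup_le fun n => ?_
                  exact Finset.single_le_sum
                    (f := fun A => ENNReal.ofReal (sampleWeight t S' A)) (fun _ _ => zero_le)
                    (by simp [traces])
              _ = ∑ A ∈ traces C z, ENNReal.ofReal
                  (∑ S' ∈ Finset.powersetCard k (Finset.univ : Finset ι), sampleWeight t S' A) := by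
                  rw [Finset.sum_comm]
                  refine Finset.sum_congr rfl fun A _ => ?_
                  rw [ENNReal.ofReal_sum_of_nonneg fun S' _ => sampleWeight_nonneg ht0 S' A]
              _ ≤ ∑ A ∈ traces C z, ENNReal.ofReal R := by
                  gcongr with A _
                  exact sum_sampleWeight_le ht hcard A
              _ ≤ ENNReal.ofReal (m * R) := by
                  rw [Finset.sum_const, nsmul_eq_mul, ENNReal.ofReal_mul (by positivity),
                    ENNReal.ofReal_natCast]
                  gcongr
                  exact hm z
        _ = _ := by simp
    · intro S' _
      refine Measurable.iSup fun n => ENNReal.measurable_ofReal.comp ?_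
      exact measurable_sampleWeight_hitSet S' fun i => (measurable_pi_apply i) (hC n)
  have hconst : ∀ S' ∈ Finset.powersetCard k (Finset.univ : Finset ι),
      ∫⁻ z, ⨆ n, ENNReal.ofReal (sampleWeight t S' (hitSet (C n) z)) ∂Measure.pi (fun _ : ι => P) =
      ∫⁻ z, ⨆ n, ENNReal.ofReal (sampleWeight t S (hitSet (C n) z)) ∂Measure.pi (fun _ : ι => P) :=
    fun S' hS' => lintegral_iSup_sampleWeight_eq P t C
      (hS.trans (Finset.mem_powersetCard.1 hS').2.symm)
  rw [Finset.sum_congr rfl hconst, Finset.sum_const, Finset.card_powersetCard, Finset.card_univ,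
    hcard, nsmul_eq_mul] at hsum
  rw [ENNReal.ofReal_div_of_pos hN, ENNReal.ofReal_natCast,
    ENNReal.le_div_iff_mul_le (Or.inl (by exact_mod_cast hN.ne')) (Or.inl (by simp)), mul_comm]
  exact hsum

end Exchangeable

/-! ### Random thresholds, Jensen's inequality and the tail bound -/

/-- The event that exactly one of `f` and `g` exceeds the threshold `r`. -/
def thresholdDisagreement {𝒟 : Type*} (f g : 𝒟 → ℝ) (r : ℝ) : Set 𝒟 :=
  {x | ¬ (r < f x ↔ r < g x)}

theorem measurableSet_thresholdDisagreement_comp {𝒟 Θ : Type*} [MeasurableSpace 𝒟]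
    [MeasurableSpace Θ] {f g : 𝒟 → ℝ} (hf : Measurable f) (hg : Measurable g) {r : Θ → ℝ}
    {x : Θ → 𝒟} (hr : Measurable r) (hx : Measurable x) :
    MeasurableSet {θ | x θ ∈ thresholdDisagreement f g (r θ)} := by
  have h1 : MeasurableSet {θ | r θ < f (x θ)} := measurableSet_lt hr (hf.comp hx)
  have h2 : MeasurableSet {θ | r θ < g (x θ)} := measurableSet_lt hr (hg.comp hx)
  exact (h1.iff h2).compl

theorem measurableSet_thresholdDisagreement {𝒟 : Type*} [MeasurableSpace 𝒟] {f g : 𝒟 → ℝ}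
    (hf : Measurable f) (hg : Measurable g) (r : ℝ) :
    MeasurableSet (thresholdDisagreement f g r) :=
  measurableSet_thresholdDisagreement_comp hf hg measurable_const measurable_id

/-- A threshold separates the two values exactly when it lies in [min, max), an interval of length
|f x - g x|. -/
theorem setIntegral_indicator_thresholdDisagreement {𝒟 : Type*} {f g : 𝒟 → ℝ}
    (hf : ∀ x, f x ∈ Set.Icc (0 : ℝ) 1) (hg : ∀ x, g x ∈ Set.Icc (0 : ℝ) 1) (x : 𝒟) :
    ∫ r in Set.Ioc (0 : ℝ) 1, (thresholdDisagreement f g r).indicator (fun _ => (1 : ℝ)) x =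
      |f x - g x| := by
  have hset : ∀ r, (thresholdDisagreement f g r).indicator (fun _ => (1 : ℝ)) x =
      (Set.Ico (min (f x) (g x)) (max (f x) (g x))).indicator (fun _ => (1 : ℝ)) r := by
    intro r
    simp only [Set.indicator_apply, thresholdDisagreement, Set.mem_ofPred_eq, Set.mem_Ico]
    congr 1
    rw [min_le_iff, lt_max_iff, eq_iff_iff]
    constructor
    · intro h
      by_cases h1 : r < f x <;> by_cases h2 : r < g x <;> simp_all
    · rintro ⟨h1, h2⟩ h3
      rcases h1 with h1 | h1 <;> rcases h2 with h2 | h2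
      · linarith
      · linarith [h3.2 h2]
      · linarith [h3.1 h2]
      · linarith
  simp_rw [hset]
  -- The interval may contain 0, which `Set.Ioc 0 1` misses; hence the passage to `Set.Icc`, equal
  -- up to a null set.
  rw [integral_indicator measurableSet_Ico, setIntegral_const, smul_eq_mul, mul_one,
    measureReal_def, Measure.restrict_apply measurableSet_Ico,
    ← Measure.restrict_apply' measurableSet_Ioc,
    Measure.restrict_congr_set Ioc_ae_eq_Icc, Measure.restrict_apply measurableSet_Ico,
    Set.inter_eq_left.2, Real.volume_Ico, max_sub_min_eq_abs, ENNReal.toReal_ofReal (abs_nonneg _),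
    abs_sub_comm]
  exact fun r hr => ⟨(le_min (hf x).1 (hg x).1).trans hr.1, hr.2.le.trans (max_le (hf x).2 (hg x).2)⟩

theorem sampleWeight_sum_elim {𝒟 : Type*} {t : ℝ} (ht : 0 < t) {k m : ℕ} (C : Set 𝒟)
    (w : Fin k → 𝒟) (w' : Fin m → 𝒟) :
    sampleWeight t (Finset.univ.map Function.Embedding.inl) (hitSet C (Sum.elim w w')) =
      Real.exp (Real.log t * (∑ j, C.indicator (fun _ => (1 : ℝ)) (w' j) -
        4 * ∑ i, C.indicator (fun _ => (1 : ℝ)) (w i))) := by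
  have hsum : Real.log t * (∑ j, C.indicator (fun _ => (1 : ℝ)) (w' j) -
        4 * ∑ i, C.indicator (fun _ => (1 : ℝ)) (w i)) =
      ∑ i, -(4 * Real.log t) * C.indicator (fun _ => (1 : ℝ)) (w i) +
        ∑ j, Real.log t * C.indicator (fun _ => (1 : ℝ)) (w' j) := by
    rw [← Finset.mul_sum, ← Finset.mul_sum]; ring
  rw [hsum, Real.exp_add, Real.exp_sum, Real.exp_sum, sampleWeight, Fintype.prod_sum_type]
  congr 1
  · refine Finset.prod_congr rfl fun i _ => ?_
    by_cases h : w i ∈ C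
    · have : Sum.inl i ∈ hitSet C (Sum.elim w w') := mem_hitSet.2 h
      simp only [this, if_true, Set.indicator_of_mem h, mul_one]
      rw [if_pos (by simp), Real.exp_neg, show 4 * Real.log t = Real.log (t ^ 4) by
        rw [Real.log_pow]; norm_num, Real.exp_log (by positivity)]
    · have : Sum.inl i ∉ hitSet C (Sum.elim w w') := mem_hitSet.not.2 h
      simp [this, h]
  · refine Finset.prod_congr rfl fun i _ => ?_
    by_cases h : w' i ∈ C
    · have : Sum.inr i ∈ hitSet C (Sum.elim w w') := mem_hitSet.2 h
      simp only [this, if_true, Set.indicator_of_mem h, mul_one]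
      rw [if_neg (by simp), Real.exp_log ht]
    · have : Sum.inr i ∉ hitSet C (Sum.elim w w') := mem_hitSet.not.2 h
      simp [this, h]

/-- The excess of the expected absolute deviation of `f` from `g` over its empirical mean. -/
noncomputable def deviation {𝒟 : Type*} [MeasurableSpace 𝒟] (P : Measure 𝒟) (f g : 𝒟 → ℝ) {k : ℕ}
    (w : Fin k → 𝒟) : ℝ :=
  ∫ x, |f x - g x| ∂P - (1 / (k : ℝ)) * ∑ i, |f (w i) - g (w i)|

section Deviation

variable {𝒟 : Type*} [MeasurableSpace 𝒟] (P : Measure 𝒟) [IsProbabilityMeasure P]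

/-- The law of a uniform threshold together with an independent ghost sample. -/
noncomputable abbrev thresholdGhost (m : ℕ) : Measure (ℝ × (Fin m → 𝒟)) :=
  (volume.restrict (Set.Ioc (0 : ℝ) 1)).prod (Measure.pi fun _ => P)

instance isProbabilityMeasure_restrict_Ioc_zero_one :
    IsProbabilityMeasure ((volume : Measure ℝ).restrict (Set.Ioc (0 : ℝ) 1)) :=
  ⟨by simp⟩

variable {P} {f g : 𝒟 → ℝ}

theorem integral_thresholdGhost_ghost (hf : Measurable f) (hg : Measurable g)
    (hf1 : ∀ x, f x ∈ Set.Icc (0 : ℝ) 1) (hg1 : ∀ x, g x ∈ Set.Icc (0 : ℝ) 1) {m : ℕ} (j : Fin m) :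
    Integrable (fun p : ℝ × (Fin m → 𝒟) =>
      (thresholdDisagreement f g p.1).indicator (fun _ => (1 : ℝ)) (p.2 j)) (thresholdGhost P m) ∧
    ∫ p : ℝ × (Fin m → 𝒟), (thresholdDisagreement f g p.1).indicator (fun _ => (1 : ℝ)) (p.2 j)
      ∂(thresholdGhost P m) = ∫ x, |f x - g x| ∂P := by
  have hms : MeasurableSet {p : ℝ × (Fin m → 𝒟) | p.2 j ∈ thresholdDisagreement f g p.1} :=
    measurableSet_thresholdDisagreement_comp hf hg measurable_fst
      ((measurable_pi_apply j).comp measurable_snd)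
  have hint : Integrable (fun p : ℝ × (Fin m → 𝒟) =>
      (thresholdDisagreement f g p.1).indicator (fun _ => (1 : ℝ)) (p.2 j))
      (thresholdGhost P m) := by
    have := (integrable_const (μ := thresholdGhost P m) (1 : ℝ)).indicator hms
    exact this
  refine ⟨hint, ?_⟩
  rw [integral_prod_symm _ hint]
  simp only [setIntegral_indicator_thresholdDisagreement hf1 hg1]
  have hmp := measurePreserving_eval (fun _ : Fin m => P) j
  have := integral_map (μ := Measure.pi fun _ : Fin m => P) (φ := fun w => w j)
    (measurable_pi_apply j).aemeasurable (f := fun x => |f x - g x|)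
    (by exact (hf.sub hg).abs.aestronglyMeasurable)
  rw [← this, show Measure.map (fun w : Fin m → 𝒟 => w j) (Measure.pi fun _ => P) = P from hmp.map_eq]

theorem integral_thresholdGhost_sample (hf : Measurable f) (hg : Measurable g)
    (hf1 : ∀ x, f x ∈ Set.Icc (0 : ℝ) 1) (hg1 : ∀ x, g x ∈ Set.Icc (0 : ℝ) 1) (m : ℕ) (x : 𝒟) :
    Integrable (fun p : ℝ × (Fin m → 𝒟) =>
      (thresholdDisagreement f g p.1).indicator (fun _ => (1 : ℝ)) x) (thresholdGhost P m) ∧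
    ∫ p : ℝ × (Fin m → 𝒟), (thresholdDisagreement f g p.1).indicator (fun _ => (1 : ℝ)) x
      ∂(thresholdGhost P m) = |f x - g x| := by
  have hms : MeasurableSet {p : ℝ × (Fin m → 𝒟) | x ∈ thresholdDisagreement f g p.1} :=
    measurableSet_thresholdDisagreement_comp hf hg measurable_fst measurable_const
  have hint : Integrable (fun p : ℝ × (Fin m → 𝒟) =>
      (thresholdDisagreement f g p.1).indicator (fun _ => (1 : ℝ)) x)
      (thresholdGhost P m) := by
    have := (integrable_const (μ := thresholdGhost P m) (1 : ℝ)).indicator hms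
    exact this
  refine ⟨hint, ?_⟩
  rw [integral_prod_symm _ hint]
  simp [setIntegral_indicator_thresholdDisagreement hf1 hg1]

theorem measurable_sampleWeight_thresholdDisagreement {t : ℝ} {k m : ℕ} (hf : Measurable f)
    (hg : Measurable g) :
    Measurable fun q : (Fin k → 𝒟) × (ℝ × (Fin m → 𝒟)) =>
      sampleWeight t (Finset.univ.map Function.Embedding.inl)
        (hitSet (thresholdDisagreement f g q.2.1) (Sum.elim q.1 q.2.2)) := by
  refine measurable_sampleWeight_hitSet _ fun i => ?_
  refine measurableSet_thresholdDisagreement_comp hf hg (by fun_prop) ?_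
  rcases i with i | i
  · exact (measurable_pi_apply i).comp measurable_fst
  · exact (measurable_pi_apply i).comp (measurable_snd.comp measurable_snd)

/-- Jensen's inequality for the threshold and the ghost sample. -/
theorem exp_deviation_le {t : ℝ} (ht : 1 < t) {k : ℕ} (hk : 0 < k) (hf : Measurable f)
    (hg : Measurable g) (hf1 : ∀ x, f x ∈ Set.Icc (0 : ℝ) 1) (hg1 : ∀ x, g x ∈ Set.Icc (0 : ℝ) 1)
    (w : Fin k → 𝒟) :
    ENNReal.ofReal (Real.exp (Real.log t * (4 * k * deviation P f g w))) ≤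
      ∫⁻ p, ENNReal.ofReal (sampleWeight t (Finset.univ.map Function.Embedding.inl)
        (hitSet (thresholdDisagreement f g p.1) (Sum.elim w p.2))) ∂(thresholdGhost P (4 * k)) := by
  have ht0 : 0 < t := by linarith
  have hk0 : (0 : ℝ) < k := by exact_mod_cast hk
  let Z : ℝ × (Fin (4 * k) → 𝒟) → ℝ := fun p => Real.log t *
    (∑ j, (thresholdDisagreement f g p.1).indicator (fun _ => (1 : ℝ)) (p.2 j) -
      4 * ∑ i, (thresholdDisagreement f g p.1).indicator (fun _ => (1 : ℝ)) (w i))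
  have hi1 := integrable_finsetSum (μ := thresholdGhost P (4 * k)) Finset.univ fun j _ =>
    (integral_thresholdGhost_ghost (P := P) hf hg hf1 hg1 (m := 4 * k) j).1
  have hi2 := integrable_finsetSum (μ := thresholdGhost P (4 * k)) Finset.univ fun i _ =>
    (integral_thresholdGhost_sample (P := P) hf hg hf1 hg1 (4 * k) (w i)).1
  have hZi : Integrable Z (thresholdGhost P (4 * k)) := (hi1.sub (hi2.const_mul 4)).const_mul _
  have hZ : ∫ p, Z p ∂(thresholdGhost P (4 * k)) = Real.log t * (4 * k * deviation P f g w) := by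
    simp only [Z]
    rw [integral_const_mul, integral_sub hi1 (hi2.const_mul 4), integral_const_mul,
      integral_finsetSum _ fun j _ =>
        (integral_thresholdGhost_ghost (P := P) hf hg hf1 hg1 (m := 4 * k) j).1,
      integral_finsetSum _ fun i _ =>
        (integral_thresholdGhost_sample (P := P) hf hg hf1 hg1 (4 * k) (w i)).1]
    simp only [(integral_thresholdGhost_ghost (P := P) hf hg hf1 hg1 _).2,
      (integral_thresholdGhost_sample (P := P) hf hg hf1 hg1 (4 * k) _).2, deviation]
    rw [Finset.sum_const, Finset.card_univ, Fintype.card_fin, nsmul_eq_mul]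
    push_cast
    field_simp
  have hexp : ∀ p, sampleWeight t (Finset.univ.map Function.Embedding.inl)
      (hitSet (thresholdDisagreement f g p.1) (Sum.elim w p.2)) = Real.exp (Z p) :=
    fun p => sampleWeight_sum_elim ht0 _ w p.2
  have hmeas : Measurable fun p : ℝ × (Fin (4 * k) → 𝒟) => Real.exp (Z p) := by
    have h := measurable_sampleWeight_hitSet (t := t)
      (Finset.univ.map (Function.Embedding.inl : Fin k ↪ Fin k ⊕ Fin (4 * k)))
      (C := fun p : ℝ × (Fin (4 * k) → 𝒟) => thresholdDisagreement f g p.1)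
      (z := fun p => Sum.elim w p.2) (fun i => by
        refine measurableSet_thresholdDisagreement_comp hf hg measurable_fst ?_
        rcases i with i | i
        · exact measurable_const
        · exact (measurable_pi_apply i).comp measurable_snd)
    simpa only [hexp] using h
  have hbound : ∀ p, ‖Real.exp (Z p)‖ ≤ Real.exp (Real.log t * (4 * k)) := by
    intro p
    rw [Real.norm_eq_abs, Real.abs_exp, Real.exp_le_exp]
    have hlt : 0 ≤ Real.log t := Real.log_nonneg ht.le
    refine mul_le_mul_of_nonneg_left ?_ hlt
    have h1 : ∑ j, (thresholdDisagreement f g p.1).indicator (fun _ => (1 : ℝ)) (p.2 j) ≤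
        ∑ _j : Fin (4 * k), (1 : ℝ) :=
      Finset.sum_le_sum fun j _ => Set.indicator_le_self' (fun _ _ => zero_le_one) _
    have h2 : 0 ≤ ∑ i, (thresholdDisagreement f g p.1).indicator (fun _ => (1 : ℝ)) (w i) :=
      Finset.sum_nonneg fun i _ => Set.indicator_nonneg (fun _ _ => zero_le_one) _
    simp only [Finset.sum_const, Finset.card_univ, Fintype.card_fin, nsmul_eq_mul, mul_one] at h1
    push_cast at h1
    linarith
  clear_value Z
  have hei : Integrable (fun p => Real.exp (Z p)) (thresholdGhost P (4 * k)) :=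
    Integrable.of_bound hmeas.aestronglyMeasurable _ (Filter.Eventually.of_forall hbound)
  have hJ := convexOn_exp.map_integral_le (μ := thresholdGhost P (4 * k))
    Real.continuous_exp.continuousOn isClosed_univ (by simp) hZi hei
  rw [hZ] at hJ
  simp only [hexp]
  rw [← ofReal_integral_eq_lintegral_ofReal hei
    (Filter.Eventually.of_forall fun p => (Real.exp_pos _).le)]
  exact ENNReal.ofReal_le_ofReal hJ

end Deviation

theorem lintegral_pi_sum {𝒟 : Type*} [MeasurableSpace 𝒟] (P : Measure 𝒟) [SigmaFinite P]
    {k m : ℕ} {F : (Fin k ⊕ Fin m → 𝒟) → ENNReal} (hF : Measurable F) :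
    ∫⁻ w', ∫⁻ w, F (Sum.elim w w') ∂Measure.pi (fun _ => P) ∂Measure.pi (fun _ => P) =
      ∫⁻ z, F z ∂Measure.pi (fun _ => P) := by
  have hmp := measurePreserving_sumPiEquivProdPi_symm (X := fun _ : Fin k ⊕ Fin m => 𝒟)
    (fun _ : Fin k ⊕ Fin m => P)
  rw [← hmp.lintegral_comp hF, lintegral_prod_symm' (fun a => F ((MeasurableEquiv.sumPiEquivProdPi fun _ => 𝒟).symm a))
    (hF.comp (MeasurableEquiv.measurable _))]
  refine lintegral_congr fun w' => lintegral_congr fun w => ?_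
  congr 1

/-- The tail bound for the deviations of a sequence of functions from `f`, in terms of the number
of index sets that the disagreement events cut out. -/
theorem measure_exists_deviation_le {𝒟 : Type*} [MeasurableSpace 𝒟] (P : Measure 𝒟)
    [IsProbabilityMeasure P] {t : ℝ} (ht : 1 < t) {k : ℕ} (hk : 0 < k) {f : 𝒟 → ℝ}
    {g : ℕ → 𝒟 → ℝ} (hf : Measurable f) (hg : ∀ n, Measurable (g n))
    (hf1 : ∀ x, f x ∈ Set.Icc (0 : ℝ) 1) (hg1 : ∀ n x, g n x ∈ Set.Icc (0 : ℝ) 1) {m : ℕ}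
    (hm : ∀ (r : ℝ) (z : Fin k ⊕ Fin (4 * k) → 𝒟),
      (traces (fun n => thresholdDisagreement f (g n) r) z).card ≤ m) {ε : ℝ} :
    ENNReal.ofReal (Real.exp (4 * k * ε * Real.log t)) *
      Measure.pi (fun _ : Fin k => P) {w | ∃ n, ε ≤ deviation P f (g n) w} ≤
    ENNReal.ofReal (m *
      ((1 + t + t ^ 2 + t ^ 3 + t ^ 4) ^ 5 / ((1 + t + t ^ 2 + t ^ 3) ^ 4 * t ^ 4)) ^ k /
        ((5 * k).choose k : ℝ)) := by
  have hk0 : (0 : ℝ) < k := by exact_mod_cast hk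
  have hlt : 0 ≤ Real.log t := Real.log_nonneg ht.le
  let H : (Fin k → 𝒟) → ℝ × (Fin (4 * k) → 𝒟) → ENNReal := fun w p =>
    ⨆ n, ENNReal.ofReal (sampleWeight t (Finset.univ.map Function.Embedding.inl)
      (hitSet (thresholdDisagreement f (g n) p.1) (Sum.elim w p.2)))
  have hH : Measurable (Function.uncurry H) := Measurable.iSup fun n =>
    ENNReal.measurable_ofReal.comp (measurable_sampleWeight_thresholdDisagreement hf (hg n))
  have hsub : {w : Fin k → 𝒟 | ∃ n, ε ≤ deviation P f (g n) w} ⊆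
      {w | ENNReal.ofReal (Real.exp (4 * k * ε * Real.log t)) ≤
        ∫⁻ p, H w p ∂(thresholdGhost P (4 * k))} := by
    rintro w ⟨n, hn⟩
    calc ENNReal.ofReal (Real.exp (4 * k * ε * Real.log t))
        ≤ ENNReal.ofReal (Real.exp (Real.log t * (4 * k * deviation P f (g n) w))) := by
          refine ENNReal.ofReal_le_ofReal (Real.exp_le_exp.2 ?_)
          rw [mul_comm]
          gcongr
      _ ≤ _ := exp_deviation_le ht hk hf (hg n) hf1 (hg1 n) w
      _ ≤ _ := lintegral_mono fun p => le_iSup (fun n => ENNReal.ofReal (sampleWeight t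
          (Finset.univ.map Function.Embedding.inl)
          (hitSet (thresholdDisagreement f (g n) p.1) (Sum.elim w p.2)))) n
  have hcard : Fintype.card (Fin k ⊕ Fin (4 * k)) = 5 * k := by simp; ring
  -- Markov's inequality, then Tonelli with the threshold outermost: at fixed r the disagreement
  -- events are fixed sets, so exchangeability applies.
  calc _ ≤ ENNReal.ofReal (Real.exp (4 * k * ε * Real.log t)) *
        Measure.pi (fun _ : Fin k => P) {w | ENNReal.ofReal (Real.exp (4 * k * ε * Real.log t)) ≤
          ∫⁻ p, H w p ∂(thresholdGhost P (4 * k))} := by gcongr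
    _ ≤ ∫⁻ w, ∫⁻ p, H w p ∂(thresholdGhost P (4 * k)) ∂Measure.pi (fun _ : Fin k => P) :=
        mul_meas_ge_le_lintegral (hH.lintegral_prod_right') _
    _ = ∫⁻ p, ∫⁻ w, H w p ∂Measure.pi (fun _ : Fin k => P) ∂(thresholdGhost P (4 * k)) :=
        lintegral_lintegral_swap hH.aemeasurable
    _ = ∫⁻ r in Set.Ioc (0 : ℝ) 1, ∫⁻ w', ∫⁻ w, H w (r, w') ∂Measure.pi (fun _ : Fin k => P)
          ∂Measure.pi (fun _ : Fin (4 * k) => P) :=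
        lintegral_prod _ (hH.lintegral_prod_left').aemeasurable
    _ ≤ ∫⁻ _r in Set.Ioc (0 : ℝ) 1, ENNReal.ofReal (m *
          ((1 + t + t ^ 2 + t ^ 3 + t ^ 4) ^ 5 / ((1 + t + t ^ 2 + t ^ 3) ^ 4 * t ^ 4)) ^ k /
            ((5 * k).choose k : ℝ)) := by
        refine lintegral_mono fun r => ?_
        have hFm : Measurable fun z : Fin k ⊕ Fin (4 * k) → 𝒟 => ⨆ n, ENNReal.ofReal
            (sampleWeight t (Finset.univ.map Function.Embedding.inl)
              (hitSet (thresholdDisagreement f (g n) r) z)) :=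
          Measurable.iSup fun n => ENNReal.measurable_ofReal.comp
            (measurable_sampleWeight_hitSet _ fun i =>
              (measurable_pi_apply i) (measurableSet_thresholdDisagreement hf (hg n) r))
        refine (lintegral_pi_sum P hFm).le.trans ?_
        exact lintegral_iSup_sampleWeight_le P ht hcard
          (fun n => measurableSet_thresholdDisagreement hf (hg n) r) (hm r) (by simp)
    _ = _ := by simp

/-! ### Counting traces, and reduction to a sequence -/

/-- Indices with the same image in X cannot be separated, so a shattered index set maps injectively
to X, and its image is shattered by 𝒞. -/
theorem vcDim_traces_preimage_le {ι 𝒟 X : Type*} [Fintype ι] [DecidableEq ι] {𝒞 : Set (Set X)}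
    {h : ℕ} (hVC : HasVCDim 𝒞 h) (i₀ : 𝒟 → X) {c : ℕ → Set X} (hc : ∀ n, c n ∈ 𝒞) (z : ι → 𝒟) :
    (traces (fun n => i₀ ⁻¹' c n) z).vcDim ≤ h := by
  classical
  refine Finset.sup_le fun s hs => ?_
  rw [Finset.mem_shatterer] at hs
  have key : ∀ t ⊆ s, ∃ n, ∀ i ∈ s, (i₀ (z i) ∈ c n ↔ i ∈ t) := by
    intro t ht
    obtain ⟨u, hu, hut⟩ := hs ht
    obtain ⟨n, rfl⟩ : ∃ n, hitSet (i₀ ⁻¹' c n) z = u := by simpa [traces] using hu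
    refine ⟨n, fun i hi => ?_⟩
    rw [← hut, Finset.mem_inter, mem_hitSet]
    exact ⟨fun h => ⟨hi, h⟩, fun h => h.2⟩
  have hinj : Set.InjOn (fun i => i₀ (z i)) s := by
    intro i hi j hj hij
    obtain ⟨n, hn⟩ := key {i} (by simpa using hi)
    have h1 := (hn i hi).2 (by simp)
    have h2 := (hn j hj).1 (by rw [← show i₀ (z i) = i₀ (z j) from hij]; exact h1)
    exact (Finset.mem_singleton.1 h2).symm
  refine hVC.2 ⟨s.image fun i => i₀ (z i), Finset.card_image_of_injOn hinj, ?_⟩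
  intro t ht
  obtain ⟨n, hn⟩ := key (s.filter fun i => i₀ (z i) ∈ t) (Finset.filter_subset _ _)
  refine ⟨c n, hc n, fun x hx => ?_⟩
  obtain ⟨i, hi, rfl⟩ := Finset.mem_image.1 hx
  rw [hn i hi, Finset.mem_filter]
  exact ⟨fun h => h.2, fun h => ⟨hi, h⟩⟩

/-- Each C n is the symmetric difference of the fixed set E with the complement of a pullback from
𝒞. So there are no more traces than for the pullbacks, to which Sauer-Shelah applies. -/
theorem card_traces_le {ι 𝒟 X : Type*} [Fintype ι] {𝒞 : Set (Set X)} {h : ℕ}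
    (hVC : HasVCDim 𝒞 h) (i₀ : 𝒟 → X) {c : ℕ → Set X} (hc : ∀ n, c n ∈ 𝒞) (E : Set 𝒟)
    {C : ℕ → Set 𝒟} (hC : ∀ n x, x ∈ C n ↔ ¬ (x ∈ E ↔ i₀ x ∉ c n)) (z : ι → 𝒟) :
    (traces C z).card ≤ ∑ i ∈ Finset.Iic h, (Fintype.card ι).choose i := by
  classical
  let 𝒜 := traces (fun n => i₀ ⁻¹' c n) z
  have hsub : traces C z ⊆
      𝒜.image fun A => Finset.univ.filter fun i => ¬ (z i ∈ E ↔ i ∉ A) := by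
    intro A hA
    obtain ⟨n, rfl⟩ : ∃ n, hitSet (C n) z = A := by simpa [traces] using hA
    refine Finset.mem_image.2 ⟨hitSet (i₀ ⁻¹' c n) z, by simp [𝒜, traces], ?_⟩
    ext i
    simp [mem_hitSet, hC]
  calc (traces C z).card ≤ 𝒜.card := (Finset.card_le_card hsub).trans Finset.card_image_le
    _ ≤ 𝒜.shatterer.card := Finset.card_le_card_shatterer _
    _ ≤ ∑ i ∈ Finset.Iic 𝒜.vcDim, (Fintype.card ι).choose i :=
        Finset.card_shatterer_le_sum_vcDim
    _ ≤ _ := Finset.sum_le_sum_of_subset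
        (Finset.Iic_subset_Iic.2 (vcDim_traces_preimage_le hVC i₀ hc z))

/-- For countable X the product space X → ℝ is separable and metrizable, hence so is S. Inputs are
countable because they are finite tuples from a finite set. -/
theorem exists_seq_pointwise_dense {X : Type*} [Countable X] {S : Set (X → ℝ)}
    (hS : S.Nonempty) : ∃ φ : ℕ → X → ℝ, (∀ n, φ n ∈ S) ∧ ∀ f ∈ S, ∃ u : ℕ → ℕ, ∀ x,
      Filter.Tendsto (fun n => φ (u n) x) Filter.atTop (nhds (f x)) := by
  have : Nonempty S := hS.to_subtype
  obtain ⟨φ, hφ⟩ := TopologicalSpace.exists_dense_seq S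
  refine ⟨fun n => φ n, fun n => (φ n).2, fun f hf => ?_⟩
  obtain ⟨v, hv, hlim⟩ := mem_closure_iff_seq_limit.1 (hφ ⟨f, hf⟩)
  choose u hu using hv
  refine ⟨u, fun x => ?_⟩
  have h1 : Filter.Tendsto (fun n => (v n : X → ℝ)) Filter.atTop (nhds f) :=
    (continuous_subtype_val.tendsto _).comp hlim
  have h2 := (tendsto_pi_nhds.1 h1) x
  simpa [hu] using h2

/-! ### Application to models and data sets -/

namespace StatProperty

variable {V : Type*} {E : V → Type*} [∀ v, MeasurableSpace (E v)]

/-- The input is constant on each summand of the disjoint union of data spaces, so no measurability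
of f is needed. -/
theorem measurable_comp_input {Y Z : Type*} [MeasurableSpace Z] {Q : StatProperty V E Y}
    (f : Q.Input → Z) : Measurable fun D : Q.DataSet => f (DataSet.input D) := by
  intro s _
  refine MeasurableSpace.measurableSet_iInf.2 fun l => ?_
  have h : MeasurableSet {D : Σ t : Q.Allowed, Fin l → (t : VarTuple V).Values E |
      f (Quotient.mk Q.reord D.1) ∈ s} :=
    MeasurableSpace.measurableSet_iInf.2 fun t => by
      have ht : MeasurableSet {_x : Fin l → (t : VarTuple V).Values E |
        f (Quotient.mk Q.reord t) ∈ s} := MeasurableSet.const _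
      exact ht
  exact h

variable {A B : ℝ} {Q : StatProperty V E (Set.Icc A B)} {T : Q.DataSet → Set.Icc A B}

theorem measurable_absError (hT : Measurable T) (M : Q.Model) : Measurable (absError T M) :=
  ((measurable_subtype_coe.comp hT).sub
    (measurable_comp_input fun s => (M.predict s : ℝ))).abs

theorem absError_nonneg (T : Q.DataSet → Set.Icc A B) (M : Q.Model) (D : Q.DataSet) :
    0 ≤ absError T M D := abs_nonneg _

theorem absError_le (T : Q.DataSet → Set.Icc A B) (M : Q.Model) (D : Q.DataSet) :
    absError T M D ≤ B - A := by
  have h1 := (T D).2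
  have h2 := (M.predict (DataSet.input D)).2
  exact abs_le.2 ⟨by linarith [h1.1, h2.2], by linarith [h1.2, h2.1]⟩

theorem integrable_absError (hT : Measurable T) (M : Q.Model) (P : Measure Q.DataSet)
    [IsFiniteMeasure P] : Integrable (absError T M) P :=
  Integrable.of_bound (measurable_absError hT M).aestronglyMeasurable (B - A)
    (Filter.Eventually.of_forall fun D => by
      rw [Real.norm_of_nonneg (absError_nonneg T M D)]; exact absError_le T M D)

theorem expectedError_le (hT : Measurable T) (M : Q.Model) (P : Measure Q.DataSet)
    [IsProbabilityMeasure P] : expectedError T P M ≤ B - A := by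
  calc expectedError T P M ≤ ∫ _D, (B - A) ∂P :=
        integral_mono (integrable_absError hT M P) (integrable_const _) (absError_le T M)
    _ = B - A := by simp

theorem empiricalError_nonneg (T : Q.DataSet → Set.Icc A B) {k : ℕ} (D : Fin k → Q.DataSet)
    (M : Q.Model) : 0 ≤ empiricalError T D M :=
  mul_nonneg (by positivity) (Finset.sum_nonneg fun j _ => absError_nonneg T M (D j))

theorem measurable_empiricalError (hT : Measurable T) {k : ℕ} (M : Q.Model) :
    Measurable fun D : Fin k → Q.DataSet => empiricalError T D M :=
  (Finset.measurable_sum _ fun j _ =>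
    (measurable_absError hT M).comp (measurable_pi_apply j)).const_mul _

theorem tendsto_absError (T : Q.DataSet → Set.Icc A B) {M : ℕ → Q.Model} {N : Q.Model}
    (h : ∀ s, Filter.Tendsto (fun n => ((M n).predict s : ℝ)) Filter.atTop (nhds (N.predict s)))
    (D : Q.DataSet) :
    Filter.Tendsto (fun n => absError T (M n) D) Filter.atTop (nhds (absError T N D)) :=
  ((h (DataSet.input D)).const_sub (T D : ℝ)).abs

theorem tendsto_expectedError (hT : Measurable T) (P : Measure Q.DataSet) [IsFiniteMeasure P]
    {M : ℕ → Q.Model} {N : Q.Model}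
    (h : ∀ s, Filter.Tendsto (fun n => ((M n).predict s : ℝ)) Filter.atTop (nhds (N.predict s))) :
    Filter.Tendsto (fun n => expectedError T P (M n)) Filter.atTop
      (nhds (expectedError T P N)) := by
  refine tendsto_integral_of_dominated_convergence (fun _ => B - A)
    (fun n => (measurable_absError hT (M n)).aestronglyMeasurable) (integrable_const _)
    (fun n => Filter.Eventually.of_forall fun D => ?_)
    (Filter.Eventually.of_forall fun D => tendsto_absError T h D)
  rw [Real.norm_of_nonneg (absError_nonneg T _ D)]
  exact absError_le T _ D

theorem tendsto_empiricalError (T : Q.DataSet → Set.Icc A B) {k : ℕ} (D : Fin k → Q.DataSet)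
    {M : ℕ → Q.Model} {N : Q.Model}
    (h : ∀ s, Filter.Tendsto (fun n => ((M n).predict s : ℝ)) Filter.atTop (nhds (N.predict s))) :
    Filter.Tendsto (fun n => empiricalError T D (M n)) Filter.atTop
      (nhds (empiricalError T D N)) :=
  (tendsto_finsetSum _ fun j _ => tendsto_absError T h (D j)).const_mul _

/-- The predictions of a class of models are pointwise limits of those of a sequence of models
of the class. -/
theorem exists_seq_model [Finite V] {𝓜 : Set Q.Model} (h𝓜 : 𝓜.Nonempty) :
    ∃ M : ℕ → Q.Model, (∀ n, M n ∈ 𝓜) ∧ ∀ N ∈ 𝓜, ∃ u : ℕ → ℕ, ∀ s,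
      Filter.Tendsto (fun n => ((M (u n)).predict s : ℝ)) Filter.atTop (nhds (N.predict s)) := by
  obtain ⟨φ, hφ, hlim⟩ := exists_seq_pointwise_dense
    (S := (fun (M : Q.Model) (s : Q.Input) => (M.predict s : ℝ)) '' 𝓜) (h𝓜.image _)
  choose M hM hMφ using hφ
  refine ⟨M, hM, fun N hN => ?_⟩
  obtain ⟨u, hu⟩ := hlim _ ⟨N, hN, rfl⟩
  refine ⟨u, fun s => ?_⟩
  simpa only [← hMφ] using hu s

/-- Cutting out the empty subset of a shattered set already needs a model. With one model,
thresholds B and A - 1 shatter any single input. -/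
theorem one_le_of_hasRealVCDim {𝓜 : Set Q.Model} {h : ℕ} [Nonempty Q.Input]
    (hVC : HasRealVCDim {f : Q.Input → ℝ | ∃ M ∈ 𝓜, f = fun s => (M.predict s : ℝ)} h) :
    𝓜.Nonempty ∧ 1 ≤ h := by
  obtain ⟨s, -, hs⟩ := hVC.1
  obtain ⟨c, ⟨f, ⟨M, hM, hf⟩, -⟩, -⟩ := hs ∅ (Finset.empty_subset _)
  refine ⟨⟨M, hM⟩, hVC.2 ?_⟩
  obtain ⟨x⟩ := ‹Nonempty Q.Input›
  refine ⟨{x}, Finset.card_singleton x, fun t _ => ?_⟩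
  by_cases hx : x ∈ t
  · refine ⟨_, ⟨_, ⟨M, hM, rfl⟩, B, rfl⟩, fun y hy => ?_⟩
    rw [Finset.mem_singleton.1 hy]
    exact ⟨fun _ => hx, fun _ => (M.predict x).2.2⟩
  · refine ⟨_, ⟨_, ⟨M, hM, rfl⟩, A - 1, rfl⟩, fun y hy => ?_⟩
    rw [Finset.mem_singleton.1 hy]
    refine ⟨fun h => ?_, fun h => absurd h hx⟩
    have h1 : (M.predict x : ℝ) ≤ A - 1 := h
    linarith [(M.predict x).2.1]

/-- The value `v ∈ [A, B]`, rescaled to the unit interval. -/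
noncomputable def rescale (A B v : ℝ) : ℝ := (v - A) / (B - A)

theorem rescale_mem_Icc (hAB : A < B) {v : ℝ} (hv : v ∈ Set.Icc A B) :
    rescale A B v ∈ Set.Icc (0 : ℝ) 1 := by
  have : 0 < B - A := by linarith
  exact ⟨div_nonneg (by linarith [hv.1]) this.le, (div_le_one this).2 (by linarith [hv.2])⟩

theorem lt_rescale_iff (hAB : A < B) {r v : ℝ} :
    r < rescale A B v ↔ A + (B - A) * r < v := by
  rw [rescale, lt_div_iff₀ (by linarith)]
  constructor <;> intro h <;> linarith

theorem deviation_rescale (hAB : A < B) (P : Measure Q.DataSet) (M : Q.Model) {k : ℕ}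
    (w : Fin k → Q.DataSet) :
    deviation P (fun D => rescale A B (T D)) (fun D => rescale A B (M.predict (DataSet.input D))) w =
      (expectedError T P M - empiricalError T w M) / (B - A) := by
  have hBA : 0 < B - A := by linarith
  have h : ∀ D, |rescale A B (T D) - rescale A B (M.predict (DataSet.input D))| =
      absError T M D / (B - A) := by
    intro D
    rw [rescale, rescale, ← sub_div, abs_div, abs_of_pos hBA, absError]
    congr 2
    ring
  simp only [deviation, h, expectedError, empiricalError]
  rw [integral_div, ← Finset.sum_div]
  ring

theorem measure_exists_lt_expectedError_le (hAB : A < B) (hT : Measurable T) {𝓜 : Set Q.Model}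
    {h : ℕ} (hVC : HasRealVCDim {f : Q.Input → ℝ | ∃ M ∈ 𝓜, f = fun s => (M.predict s : ℝ)} h)
    (hh : 1 ≤ h) (P : Measure Q.DataSet) [IsProbabilityMeasure P] {k : ℕ} (hk : h ≤ k)
    {η ε : ℝ} (hη0 : 0 < η) (hη1 : η < 1)
    (hε : k * ε ^ 2 = h * (Real.log (k / h) + 1) - Real.log (η / 4)) (hε0 : 0 < ε) (hε1 : ε < 1)
    {M : ℕ → Q.Model} (hM : ∀ n, M n ∈ 𝓜) :
    Measure.pi (fun _ : Fin k => P) {w | ∃ n, empiricalError T w (M n) + (B - A) * ε <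
      expectedError T P (M n)} ≤ ENNReal.ofReal η := by
  have hBA : 0 < B - A := by linarith
  obtain ⟨t, ht, H⟩ := exists_tail_bound hh hk hη0 hη1 hε hε0 hε1
  have hk0 : 0 < k := hh.trans hk
  have hbound := measure_exists_deviation_le P ht hk0 (ε := ε)
    (m := ∑ i ∈ Finset.Iic h, (5 * k).choose i)
    (f := fun D => rescale A B (T D))
    (g := fun n D => rescale A B ((M n).predict (DataSet.input D)))
    (((measurable_subtype_coe.comp hT).sub_const A).div_const _)
    (fun n => measurable_comp_input fun s => rescale A B ((M n).predict s))
    (fun D => rescale_mem_Icc hAB (T D).2) (fun n D => rescale_mem_Icc hAB (Subtype.mem _)) (by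
      intro r z
      -- Undoing the rescaling turns threshold r into A + (B - A) r, so the models enter only
      -- through their sublevel sets.
      refine (card_traces_le hVC DataSet.input
        (c := fun n => (fun s => ((M n).predict s : ℝ)) ⁻¹' Set.Iic (A + (B - A) * r))
        (fun n => ⟨_, ⟨M n, hM n, rfl⟩, _, rfl⟩) {D | A + (B - A) * r < T D} (fun n D => ?_)
        z).trans_eq ?_
      · simp [thresholdDisagreement, lt_rescale_iff hAB]
      · refine Finset.sum_congr rfl fun i _ => ?_
        rw [show Fintype.card (Fin k ⊕ Fin (4 * k)) = 5 * k by simp; ring])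
  have hsub : {w : Fin k → Q.DataSet | ∃ n, empiricalError T w (M n) + (B - A) * ε <
      expectedError T P (M n)} ⊆ {w | ∃ n, ε ≤ deviation P (fun D => rescale A B (T D))
        (fun D => rescale A B ((M n).predict (DataSet.input D))) w} := by
    rintro w ⟨n, hn⟩
    refine ⟨n, ?_⟩
    rw [deviation_rescale hAB, le_div_iff₀ hBA]
    linarith
  have hpos := Real.exp_pos (4 * k * ε * Real.log t)
  have h1 := hbound.trans (ENNReal.ofReal_le_ofReal H)
  rw [mul_comm η, ENNReal.ofReal_mul hpos.le] at h1
  refine (measure_mono hsub).trans ?_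
  exact (ENNReal.mul_le_mul_iff_right (ENNReal.ofReal_pos.2 hpos).ne' ENNReal.ofReal_ne_top).1 h1

end StatProperty

theorem mainTheorem7
    {V : Type*} [Fintype V] {E : V → Type*} [∀ v, MeasurableSpace (E v)]
    {A B : ℝ} (Q : StatProperty V E (Set.Icc A B))
    (T : Q.DataSet → Set.Icc A B) (hT : Measurable T)
    (𝓜 : Set Q.Model) (h : ℕ)
    (hVC : HasRealVCDim {f : Q.Input → ℝ | ∃ M ∈ 𝓜, f = fun s => (M.predict s : ℝ)} h)
    (P : Measure Q.DataSet) [IsProbabilityMeasure P]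
    {Ω : Type*} [MeasurableSpace Ω] (μ : Measure Ω) [IsProbabilityMeasure μ]
    (k : ℕ) (hk : h ≤ k) (D : Fin k → Ω → Q.DataSet)
    (hDm : ∀ j, Measurable (D j)) (hDlaw : ∀ j, μ.map (D j) = P) (hDind : iIndepFun D μ)
    (η : ℝ) (hη0 : 0 < η) (hη1 : η < 1) :
    MeasurableSet {ω | ∀ M ∈ 𝓜,
        StatProperty.expectedError T P M ≤
          StatProperty.empiricalError T (fun j => D j ω) M +
            (B - A) * √((h * (Real.log (k / h) + 1) - Real.log (η / 4)) / k)} ∧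
    ENNReal.ofReal (1 - η) ≤ μ {ω | ∀ M ∈ 𝓜,
        StatProperty.expectedError T P M ≤
          StatProperty.empiricalError T (fun j => D j ω) M +
            (B - A) * √((h * (Real.log (k / h) + 1) - Real.log (η / 4)) / k)} := by
  have hne : Nonempty Q.DataSet := nonempty_of_isProbabilityMeasure P
  have : Nonempty Q.Input := hne.map StatProperty.DataSet.input
  obtain ⟨h𝓜, hh⟩ := StatProperty.one_le_of_hasRealVCDim hVC
  have hAB : A ≤ B := hne.elim fun D => (T D).2.1.trans (T D).2.2
  have hk1 : 1 ≤ k := hh.trans hk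
  have hk0 : (0 : ℝ) < k := by exact_mod_cast hk1
  have hh0 : (0 : ℝ) < h := by exact_mod_cast hh
  have hnum : 0 < h * (Real.log (k / h) + 1) - Real.log (η / 4) := by
    have h1 : 0 ≤ Real.log (k / h : ℝ) :=
      Real.log_nonneg ((one_le_div hh0).2 (by exact_mod_cast hk))
    have h2 : Real.log (η / 4) < 0 := Real.log_neg (by positivity) (by linarith)
    have h3 : 0 ≤ h * (Real.log (k / h : ℝ) + 1) := by positivity
    linarith
  obtain ⟨ε, hεdef⟩ : ∃ ε, ε = √((h * (Real.log (k / h) + 1) - Real.log (η / 4)) / k) := ⟨_, rfl⟩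
  have hε0 : 0 < ε := by rw [hεdef]; exact Real.sqrt_pos.2 (by positivity)
  have hε : k * ε ^ 2 = h * (Real.log (k / h) + 1) - Real.log (η / 4) := by
    rw [hεdef, Real.sq_sqrt (by positivity)]; field_simp
  rw [← hεdef]
  obtain ⟨M, hM, hlim⟩ := StatProperty.exists_seq_model h𝓜
  let good : Set (Fin k → Q.DataSet) := {w | ∀ n, StatProperty.expectedError T P (M n) ≤
    StatProperty.empiricalError T w (M n) + (B - A) * ε}
  have hgood : MeasurableSet good := by
    have : good = ⋂ n, {w | StatProperty.expectedError T P (M n) ≤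
        StatProperty.empiricalError T w (M n) + (B - A) * ε} := by
      ext w; simp [good]
    rw [this]
    exact MeasurableSet.iInter fun n => measurableSet_le measurable_const
      ((StatProperty.measurable_empiricalError hT (M n)).add_const _)
  have hDmeas : Measurable fun ω j => D j ω := measurable_pi_lambda _ hDm
  -- The weak inequality survives pointwise limits of predictions, so the event for all of 𝓜 is a
  -- countable intersection. This gives measurability too.
  have hset : {ω | ∀ M ∈ 𝓜, StatProperty.expectedError T P M ≤
      StatProperty.empiricalError T (fun j => D j ω) M + (B - A) * ε} =
      (fun ω j => D j ω) ⁻¹' good := by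
    ext ω
    refine ⟨fun hω n => hω (M n) (hM n), fun hω N hN => ?_⟩
    obtain ⟨u, hu⟩ := hlim N hN
    exact le_of_tendsto_of_tendsto' (StatProperty.tendsto_expectedError hT P hu)
      ((StatProperty.tendsto_empiricalError T _ hu).add_const _) fun n => hω (u n)
  have hlaw : μ.map (fun ω j => D j ω) = Measure.pi fun _ => P := by
    rw [(iIndepFun_iff_map_fun_eq_pi_map fun j => (hDm j).aemeasurable).1 hDind]
    simp only [hDlaw]
  rw [hset]
  refine ⟨hDmeas hgood, ?_⟩
  rw [← Measure.map_apply hDmeas hgood, hlaw]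
  -- This covers A = B and ε ≥ 1, where the inequality always holds because errors lie in [0, B -
  -- A].
  by_cases htriv : B - A ≤ (B - A) * ε
  · have : good = Set.univ := Set.eq_univ_of_forall fun w n => by
      linarith [StatProperty.expectedError_le hT (M n) P,
        StatProperty.empiricalError_nonneg T w (M n)]
    rw [this, measure_univ]
    exact ENNReal.ofReal_le_one.2 (by linarith)
  · have hAB' : A < B := by
      refine lt_of_le_of_ne hAB fun h => htriv ?_
      rw [h]; simp
    have hε1 : ε < 1 := by
      by_contra hε1
      exact htriv (le_mul_of_one_le_right (by linarith) (not_lt.1 hε1))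
    have hbad := StatProperty.measure_exists_lt_expectedError_le hAB' hT hVC hh P hk hη0 hη1 hε
      hε0 hε1 hM
    have hcompl : goodᶜ = {w | ∃ n, StatProperty.empiricalError T w (M n) + (B - A) * ε <
        StatProperty.expectedError T P (M n)} := by
      ext w; simp [good]
    rw [← hcompl] at hbad
    have h1 := prob_compl_eq_one_sub (μ := Measure.pi fun _ : Fin k => P) hgood.compl
    rw [compl_compl] at h1
    rw [h1, ENNReal.ofReal_sub _ hη0.le, ENNReal.ofReal_one]
    gcongr
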